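/- Consider the averaged model of a DC microgrid connected to an AC grid, with state $x=(x_1,\dots,x_{12})$ (capacitor voltages $x_1,x_2,x_4,x_5,x_7,x_9,x_{10}$, inductor currents $x_3,x_6,x_8,x_{11},x_{12}$) and inputs $u=(u_1,\dots,u_5)$: $$\begin{aligned} \dot x_1&=-\tfrac{1}{R_1C_1}x_1-\tfrac1{C_1}x_3+\tfrac1{R_1C_1}V_{PV},\\ \dot x_2&=-\tfrac1{R_2C_2}x_2+\tfrac1{C_2}x_3-\tfrac1{C_2}u_1x_3+\tfrac1{R_2C_2}x_9,\\ \dot x_3&=\tfrac1{L_3}x_1-\tfrac1{L_3}x_2-\tfrac{R_{01}}{L_3}x_3+\tfrac1{L_3}x_2u_1+\tfrac{R_{01}-R_{02}}{L_3}x_3u_1,\\ \dot x_4&=-\tfrac1{R_4C_4}x_4-\tfrac1{C_4}x_6+\tfrac1{R_4C_4}V_B,\\ \dot x_5&=-\tfrac1{R_5C_5}x_5+\tfrac1{C_5}x_6-\tfrac1{C_5}u_2x_6+\tfrac1{R_5C_5}x_9,\\ \dot x_6&=\tfrac1{L_6}x_4-\tfrac1{L_6}x_5-\tfrac{R_{04}}{L_6}x_6+\tfrac1{L_6}x_5u_2,\\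 \dot x_7&=-\tfrac1{R_7C_7}x_7-\tfrac1{C_7}x_8+\tfrac1{R_7C_7}x_9,\\ \dot x_8&=\tfrac1{L_8}V_Su_3-\tfrac{R_{08}}{L_8}x_8-\tfrac1{L_8}x_7,\\ \dot x_9&=\tfrac1{C_9}\Big(\tfrac{x_2-x_9}{R_2}+\tfrac{x_5-x_9}{R_5}+\tfrac{x_7-x_9}{R_7}+\tfrac{x_{10}-x_9}{R_{10}}-\tfrac{x_9}{R_L}\Big),\\ \dot x_{10}&=-\tfrac{3}{2C_{10}}\tfrac1{x_{10}}(v_{ld}x_{11}+v_{lq}x_{12})+\tfrac1{R_{10}C_{10}}(x_9-x_{10}),\\ \dot x_{11}&=\tfrac1{L_{11}}\big[-R_{11}x_{11}+\omega x_{12}+\tfrac12x_{10}u_4-v_{ld}\big],\\ \dot x_{12}&=\tfrac1{L_{11}}\big[-R_{11}x_{12}-\omega x_{11}+\tfrac12x_{10}u_5-v_{lq}\big]. \end{aligned}$$ All $C_i,L_i,R_i$ (including the load $R_L$) and $V_{PV},V_B$ are positive constants, $v_{ld},v_{lq}\ge0$ and $\omega\in\mathbb R$ are constants, and $V_S(t)>0$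 is a possibly time-varying voltage whose current value is known to the controller. Let $x_1^*,x_4^*,x_9^*,x_{11}^*,x_{12}^*$ be references and $x_2^*,x_5^*,x_{10}^*$ voltages, with $x_9^*,x_{10}^*>0$, and put $$x^e=\Big(x_1^*,x_2^*,\tfrac{V_{PV}-x_1^*}{R_1},x_4^*,x_5^*,\tfrac{V_B-x_4^*}{R_4},x_9^*,0,x_9^*,x_{10}^*,x_{11}^*,x_{12}^*\Big).$$ Assume power balance in steady state: for each value $V_S>0$ there are constant inputs, with duty cycle $u_1\in[0,1]$, for which $x^e$ is a rest point of the model. "Asymptotically stable" is meant locally: solutions of the closed loop starting near the point exist for all later times, remain near it (uniformly in the initial time) and converge to it. **(a)** There is a state feedback $u=u(V_S,x)$, independent of the signal $V_S(\cdot)$ and smooth for $V_S>0$ and $x$ near $x^e$, such that for every signal $V_S(\cdot)>0$ the closed loop is asymptotically stable around $x^e$. **(b)** Suppose moreover that $x^e$ lies on the high-voltage branch of the steady-state equations, i.e. with $x_3^e=(V_{PV}-x_1^*)/R_1$, $$x_2^*+(R_{01}-R_{02})x_3^e>0,\quad 2x_2^*+(R_{01}-R_{02})x_3^e>x_9^*,\quad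 2x_5^*>x_9^*,\quad 2x_{10}^*>x_9^*.$$ Then the inputs can be taken as the following explicit ones. There are positive gains $K_i,\overline K_i,K_i^\alpha$ ($i=1,3,4,6,11,12$), $K_7,K_8$, and a smooth reference $z_7=z_7(x_2,x_5,x_9,x_{10})$ with $z_7(x_2^*,x_5^*,x_9^*,x_{10}^*)=x_9^*$, such that for every signal $V_S(\cdot)>0$ the model together with the integral states $$\dot\alpha_i=K_i^\alpha(x_i-x_i^*)\ (i=1,4,11,12),\qquad \dot\alpha_i=K_i^\alpha(x_i-z_i)\ (i=3,6)$$ is asymptotically stable around $(x,\alpha)=(x^e,0)$ under $$\begin{aligned} u_1&=\tfrac{1}{x_2+(R_{01}-R_{02})x_3}\left[-x_1+x_2+R_{01}x_3-L_3v_1\right],\qquad u_2=\tfrac1{x_5}\left(-x_4+x_5+R_{04}x_6+L_6v_2\right),\\ u_4&=\tfrac2{x_{10}}\left[v_{ld}+R_{11}x_{11}-\omega x_{12}-L_{11}\big(K_{11}(x_{11}-x_{11}^*)+\overline K_{11}\alpha_{11}\big)\right],\\ u_5&=\tfrac2{x_{10}}\left[v_{lq}+R_{11}x_{12}+\omega x_{11}-L_{11}\big(K_{12}(x_{12}-x_{12}^*)+\overline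 K_{12}\alpha_{12}\big)\right],\\ u_3&=\tfrac1{V_S}\left[x_7+R_{08}x_8+L_8\dot z_8-L_8K_8(x_8-z_8)\right], \end{aligned}$$ where $$\begin{aligned} z_3&=\tfrac1{R_1}(V_{PV}-x_1)+C_1K_1(x_1-x_1^*)+C_1\overline K_1\alpha_1,\\ v_1&=K_3(x_3-z_3)+\overline K_3\alpha_3-C_1\overline K_1K_1^\alpha(x_1-x_1^*)+\big(C_1K_1-\tfrac1{R_1}\big)\big(K_1(x_1-x_1^*)+\overline K_1\alpha_1\big),\\ z_6&=\tfrac1{R_4}(V_B-x_4)+C_4K_4(x_4-x_4^*)+C_4\overline K_4\alpha_4,\\ v_2&=-K_6(x_6-z_6)-\overline K_6\alpha_6+C_4\overline K_4K_4^\alpha(x_4-x_4^*)-\big(C_4K_4-\tfrac1{R_4}\big)\big(K_4(x_4-x_4^*)+\overline K_4\alpha_4\big),\\ z_8&=\tfrac1{R_7}(x_9-x_7)+C_7K_7(x_7-z_7)-C_7\dot z_7, \end{aligned}$$ and $\dot z_7,\dot z_8$ are the time derivatives of $z_7,z_8$ along the closed loop (expressed through $(x,\alpha)$; they do not involve $u_3$).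 -/

import Mathlib

open scoped ContDiff Topology

namespace Microgrid

noncomputable section

/-! ### Asymptotic stability of an equilibrium of a (possibly time-dependent) vector field -/

/-- `ξe` is asymptotically stable for `ξ' = F t ξ`: solutions that start close enough to `ξe`
exist for all later times, stay close to `ξe` (with `δ` independent of the initial time), and
converge to `ξe`.  The bound `‖γ t - ξe‖ < ε` is required of every solution, including those
that are only given on a bounded interval. -/
def AsymptoticallyStable {E : Type*} [NormedAddCommGroup E] [NormedSpace ℝ E]
    (F : ℝ → E → E) (ξe : E) : Prop :=
  (∀ ε > 0, ∃ δ > 0, ∀ (t₀ : ℝ) (ξ₀ : E), ‖ξ₀ - ξe‖ < δ →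
    (∃ γ : ℝ → E, γ t₀ = ξ₀ ∧ IsIntegralCurveOn γ F (Set.Ici t₀)) ∧
    (∀ (T : ℝ) (γ : ℝ → E), γ t₀ = ξ₀ → IsIntegralCurveOn γ F (Set.Ico t₀ T) →
      ∀ t ∈ Set.Ico t₀ T, ‖γ t - ξe‖ < ε)) ∧
  (∃ r > 0, ∀ (t₀ : ℝ) (ξ₀ : E), ‖ξ₀ - ξe‖ < r →
    ∀ γ : ℝ → E, γ t₀ = ξ₀ → IsIntegralCurveOn γ F (Set.Ici t₀) →
      Filter.Tendsto γ Filter.atTop (𝓝 ξe))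

/-! ### The averaged model -/

/-- The constant data of the grid: capacitances, inductances, resistances (with the load `RL`),
the photovoltaic and battery voltages, the AC voltages in the `dq` frame, the AC frequency. -/
structure Grid where
  C1 : ℝ
  C2 : ℝ
  C4 : ℝ
  C5 : ℝ
  C7 : ℝ
  C9 : ℝ
  C10 : ℝ
  L3 : ℝ
  L6 : ℝ
  L8 : ℝ
  L11 : ℝ
  R1 : ℝ
  R2 : ℝ
  R01 : ℝ
  R02 : ℝ
  R4 : ℝ
  R5 : ℝ
  R04 : ℝ
  R7 : ℝ
  R08 : ℝ
  R10 : ℝ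
  R11 : ℝ
  RL : ℝ
  VPV : ℝ
  VB : ℝ
  vld : ℝ
  vlq : ℝ
  freq : ℝ

/-- The sign conditions on the data. -/
structure Grid.Physical (p : Grid) : Prop where
  C1_pos : 0 < p.C1
  C2_pos : 0 < p.C2
  C4_pos : 0 < p.C4
  C5_pos : 0 < p.C5
  C7_pos : 0 < p.C7
  C9_pos : 0 < p.C9
  C10_pos : 0 < p.C10
  L3_pos : 0 < p.L3
  L6_pos : 0 < p.L6
  L8_pos : 0 < p.L8
  L11_pos : 0 < p.L11
  R1_pos : 0 < p.R1
  R2_pos : 0 < p.R2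
  R01_pos : 0 < p.R01
  R02_pos : 0 < p.R02
  R4_pos : 0 < p.R4
  R5_pos : 0 < p.R5
  R04_pos : 0 < p.R04
  R7_pos : 0 < p.R7
  R08_pos : 0 < p.R08
  R10_pos : 0 < p.R10
  R11_pos : 0 < p.R11
  RL_pos : 0 < p.RL
  VPV_pos : 0 < p.VPV
  VB_pos : 0 < p.VB
  vld_nonneg : 0 ≤ p.vld
  vlq_nonneg : 0 ≤ p.vlq

/-- The state `(x₁, …, x₁₂)`; the component `xᵢ` is `x (i - 1)`. -/
abbrev State := Fin 12 → ℝ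

/-- The inputs `(u₁, …, u₅)`; the component `uᵢ` is `u (i - 1)`. -/
abbrev Input := Fin 5 → ℝ

/-- The integral states, in the order `(α₁, α₃, α₄, α₆, α₁₁, α₁₂)`. -/
abbrev Integrators := Fin 6 → ℝ

/-- The right-hand side of the model, for the value `VS` of the supercapacitor voltage. -/
def Grid.field (p : Grid) (VS : ℝ) (u : Input) (x : State) : State :=
  let u1 := u 0
  let u2 := u 1
  let u3 := u 2
  let u4 := u 3
  let u5 := u 4
  let x1 := x 0
  let x2 := x 1
  let x3 := x 2
  let x4 := x 3
  let x5 := x 4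
  let x6 := x 5
  let x7 := x 6
  let x8 := x 7
  let x9 := x 8
  let x10 := x 9
  let x11 := x 10
  let x12 := x 11
  ![-(1 / (p.R1 * p.C1)) * x1 - 1 / p.C1 * x3 + 1 / (p.R1 * p.C1) * p.VPV,
    -(1 / (p.R2 * p.C2)) * x2 + 1 / p.C2 * x3 - 1 / p.C2 * u1 * x3 + 1 / (p.R2 * p.C2) * x9,
    1 / p.L3 * x1 - 1 / p.L3 * x2 - p.R01 / p.L3 * x3 + 1 / p.L3 * x2 * u1
      + (p.R01 - p.R02) / p.L3 * x3 * u1,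
    -(1 / (p.R4 * p.C4)) * x4 - 1 / p.C4 * x6 + 1 / (p.R4 * p.C4) * p.VB,
    -(1 / (p.R5 * p.C5)) * x5 + 1 / p.C5 * x6 - 1 / p.C5 * u2 * x6 + 1 / (p.R5 * p.C5) * x9,
    1 / p.L6 * x4 - 1 / p.L6 * x5 - p.R04 / p.L6 * x6 + 1 / p.L6 * x5 * u2,
    -(1 / (p.R7 * p.C7)) * x7 - 1 / p.C7 * x8 + 1 / (p.R7 * p.C7) * x9,
    1 / p.L8 * VS * u3 - p.R08 / p.L8 * x8 - 1 / p.L8 * x7,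
    1 / p.C9 * (1 / p.R2 * (x2 - x9) + 1 / p.R5 * (x5 - x9))
      + 1 / p.C9 * (1 / p.R7 * (x7 - x9) + 1 / p.R10 * (x10 - x9) - 1 / p.RL * x9),
    -(3 / (2 * p.C10)) * (1 / x10) * (p.vld * x11 + p.vlq * x12)
      + 1 / (p.R10 * p.C10) * (x9 - x10),
    1 / p.L11 * (-p.R11 * x11 + p.freq * x12 + 1 / 2 * x10 * u4 - p.vld),
    1 / p.L11 * (-p.R11 * x12 - p.freq * x11 + 1 / 2 * x10 * u5 - p.vlq)]

/-- The references `x₁*, x₄*, x₉*, x₁₁*, x₁₂*` and the resulting steady-state voltages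
`x₂*, x₅*, x₁₀*`. -/
structure Reference where
  x1 : ℝ
  x2 : ℝ
  x4 : ℝ
  x5 : ℝ
  x9 : ℝ
  x10 : ℝ
  x11 : ℝ
  x12 : ℝ

/-- The equilibrium point `x^e`. -/
def Grid.equilibrium (p : Grid) (r : Reference) : State :=
  ![r.x1, r.x2, 1 / p.R1 * (p.VPV - r.x1), r.x4, r.x5, 1 / p.R4 * (p.VB - r.x4),
    r.x9, 0, r.x9, r.x10, r.x11, r.x12]

/-- The references are feasible (power balance in steady state): the DC voltages `x₉*`, `x₁₀*`
are positive and, whatever the value of the supercapacitor voltage, `x^e` is a rest point of the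
model for suitable constant inputs, the duty cycle `u₁` being in `[0, 1]`. -/
structure Grid.Feasible (p : Grid) (r : Reference) : Prop where
  x9_pos : 0 < r.x9
  x10_pos : 0 < r.x10
  balance : ∀ VS : ℝ, 0 < VS →
    ∃ u : Input, u 0 ∈ Set.Icc (0 : ℝ) 1 ∧ p.field VS u (p.equilibrium r) = 0

/-- The operating point is on the high-voltage branch: given the other references, the
steady-state equations are quadratic in each of `x₂*`, `x₅*`, `x₁₀*`, and each of these is the
larger root; moreover the denominator of the law for `u₁` is positive. -/
structure Grid.HighVoltage (p : Grid) (r : Reference) : Prop where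
  den_pos : 0 < r.x2 + (p.R01 - p.R02) * (1 / p.R1 * (p.VPV - r.x1))
  x2_high : r.x9 < 2 * r.x2 + (p.R01 - p.R02) * (1 / p.R1 * (p.VPV - r.x1))
  x5_high : r.x9 < 2 * r.x5
  x10_high : r.x9 < 2 * r.x10

/-! ### The explicit control laws -/

/-- The gains `Kᵢ`, `K̄ᵢ` (`Kbᵢ`), `Kᵢ^α` (`Kaᵢ`). -/
structure Gains where
  K1 : ℝ
  Kb1 : ℝ
  Ka1 : ℝ
  K3 : ℝ
  Kb3 : ℝ
  Ka3 : ℝ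
  K4 : ℝ
  Kb4 : ℝ
  Ka4 : ℝ
  K6 : ℝ
  Kb6 : ℝ
  Ka6 : ℝ
  K11 : ℝ
  Kb11 : ℝ
  Ka11 : ℝ
  K12 : ℝ
  Kb12 : ℝ
  Ka12 : ℝ
  K7 : ℝ
  K8 : ℝ

/-- All gains are positive. -/
structure Gains.Positive (k : Gains) : Prop where
  K1_pos : 0 < k.K1
  Kb1_pos : 0 < k.Kb1
  Ka1_pos : 0 < k.Ka1
  K3_pos : 0 < k.K3
  Kb3_pos : 0 < k.Kb3
  Ka3_pos : 0 < k.Ka3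
  K4_pos : 0 < k.K4
  Kb4_pos : 0 < k.Kb4
  Ka4_pos : 0 < k.Ka4
  K6_pos : 0 < k.K6
  Kb6_pos : 0 < k.Kb6
  Ka6_pos : 0 < k.Ka6
  K11_pos : 0 < k.K11
  Kb11_pos : 0 < k.Kb11
  Ka11_pos : 0 < k.Ka11
  K12_pos : 0 < k.K12
  Kb12_pos : 0 < k.Kb12
  Ka12_pos : 0 < k.Ka12
  K7_pos : 0 < k.K7
  K8_pos : 0 < k.K8

section Laws

variable (p : Grid) (r : Reference) (k : Gains)

/-- The reference `z₃` of `x₃`. -/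
def z3 (x1 α1 : ℝ) : ℝ :=
  1 / p.R1 * (p.VPV - x1) + p.C1 * k.K1 * (x1 - r.x1) + p.C1 * k.Kb1 * α1

/-- The virtual input `v₁`. -/
def v1 (x1 x3 α1 α3 : ℝ) : ℝ :=
  k.K3 * (x3 - z3 p r k x1 α1) + k.Kb3 * α3 - p.C1 * k.Kb1 * k.Ka1 * (x1 - r.x1)
    + (p.C1 * k.K1 - 1 / p.R1) * (k.K1 * (x1 - r.x1) + k.Kb1 * α1)

/-- The law for `u₁`. -/
def u1 (x1 x2 x3 α1 α3 : ℝ) : ℝ :=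
  1 / (x2 + (p.R01 - p.R02) * x3) *
    (-x1 + x2 + p.R01 * x3 - p.L3 * v1 p r k x1 x3 α1 α3)

/-- The reference `z₆` of `x₆`. -/
def z6 (x4 α4 : ℝ) : ℝ :=
  1 / p.R4 * (p.VB - x4) + p.C4 * k.K4 * (x4 - r.x4) + p.C4 * k.Kb4 * α4

/-- The virtual input `v₂`. -/
def v2 (x4 x6 α4 α6 : ℝ) : ℝ :=
  -k.K6 * (x6 - z6 p r k x4 α4) - k.Kb6 * α6 + p.C4 * k.Kb4 * k.Ka4 * (x4 - r.x4)
    - (p.C4 * k.K4 - 1 / p.R4) * (k.K4 * (x4 - r.x4) + k.Kb4 * α4)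

/-- The law for `u₂`. -/
def u2 (x4 x5 x6 α4 α6 : ℝ) : ℝ :=
  1 / x5 * (-x4 + x5 + p.R04 * x6 + p.L6 * v2 p r k x4 x6 α4 α6)

/-- The law for `u₄`. -/
def u4 (x10 x11 x12 α11 : ℝ) : ℝ :=
  2 * (1 / x10) * (p.vld + p.R11 * x11 - p.freq * x12
    - p.L11 * (k.K11 * (x11 - r.x11) + k.Kb11 * α11))

/-- The law for `u₅`. -/
def u5 (x10 x11 x12 α12 : ℝ) : ℝ :=
  2 * (1 / x10) * (p.vlq + p.R11 * x12 + p.freq * x11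
    - p.L11 * (k.K12 * (x12 - r.x12) + k.Kb12 * α12))

/-- The dynamics of the integral states. -/
def integratorField (x : State) (α : Integrators) : Integrators :=
  ![k.Ka1 * (x 0 - r.x1),
    k.Ka3 * (x 2 - z3 p r k (x 0) (α 0)),
    k.Ka4 * (x 3 - r.x4),
    k.Ka6 * (x 5 - z6 p r k (x 3) (α 2)),
    k.Ka11 * (x 10 - r.x11),
    k.Ka12 * (x 11 - r.x12)]

/-- The model with integrators, with `u₁, u₂, u₄, u₅` given by the laws above and `u₃` by the law
`w`, which may use the measured value `VS` of the supercapacitor voltage. -/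
def loopField (w : ℝ → State × Integrators → ℝ) (VS : ℝ) (ξ : State × Integrators) :
    State × Integrators :=
  let x := ξ.1
  let α := ξ.2
  (p.field VS
    ![u1 p r k (x 0) (x 1) (x 2) (α 0) (α 1),
      u2 p r k (x 3) (x 4) (x 5) (α 2) (α 3),
      w VS ξ,
      u4 p r k (x 9) (x 10) (x 11) (α 4),
      u5 p r k (x 9) (x 10) (x 11) (α 5)] x,
    integratorField p r k x α)

/-- The time derivative, along the closed loop, of a quantity `φ` that does not depend on `x₈`.
As `u₃` enters the model in the equation of `x₈` only, it is immaterial here, and is set to `0`. -/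
def dot (φ : State × Integrators → ℝ) (ξ : State × Integrators) : ℝ :=
  fderiv ℝ φ ξ (loopField p r k (fun _ _ => 0) 0 ξ)

/-- The reference `z₇` of `x₇`, a function of the voltages `(x₂, x₅, x₉, x₁₀)`. -/
def ref7 (z7 : ℝ × ℝ × ℝ × ℝ → ℝ) (ξ : State × Integrators) : ℝ :=
  z7 (ξ.1 1, ξ.1 4, ξ.1 8, ξ.1 9)

/-- The backstepping reference `z₈` of `x₈`. It does not depend on `x₈`, since
`x₈` does not enter the equations of `x₂, x₅, x₉, x₁₀`. -/
def ref8 (z7 : ℝ × ℝ × ℝ × ℝ → ℝ) (ξ : State × Integrators) : ℝ :=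
  1 / p.R7 * (ξ.1 8 - ξ.1 6) + p.C7 * k.K7 * (ξ.1 6 - ref7 z7 ξ)
    - p.C7 * dot p r k (ref7 z7) ξ

/-- The backstepping law for `u₃`. -/
def u3 (z7 : ℝ × ℝ × ℝ × ℝ → ℝ) (VS : ℝ) (ξ : State × Integrators) : ℝ :=
  1 / VS * (ξ.1 6 + p.R08 * ξ.1 7 + p.L8 * dot p r k (ref8 p r k z7) ξ
    - p.L8 * (k.K8 * (ξ.1 7 - ref8 p r k z7 ξ)))

end Laws

end

end Microgrid

open Microgrid

open Microgrid

/-! Since `V_S` enters the model only through the product `V_S u₃`, and both laws for `u₃` carry the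
factor `1 / V_S`, each closed loop is autonomous and `V_S` may be taken to be 1. Both halves then
follow from Lyapunov's direct method (`asymptoticallyStable_of_lyapunov`): it suffices to find `V`
positive definite near the equilibrium whose derivative is at most `-N`, with `N` positive definite.

For (a) the model is essentially a passive circuit. With the duty cycles frozen at their steady
values and `V_S u₃ = 2 x₇ - x₉*`, the error equations are lossless (skew) couplings plus resistors,
so the stored energy decreases. The exception is the constant-power term in the equation of `x₁₀`.
It is removed by letting the references of `x₁₁`, `x₁₂` vary with `x₁₀` so that the power they carry
is proportional to `x₁₀`, hence the current is constant. The remaining errors of `x₁₁`, `x₁₂` decay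
by themselves, and a large weight `M` on them absorbs their effect on `x₁₀`
(`dissipation_inequality`).

For (b) the closed loop is a cascade. The errors of `x₃, x₆, x₁₁, x₁₂` with their integrators, and
that of `x₈`, decay autonomously; they drive the errors of `x₁, x₄` with their integrators and of
`x₇`; all of these drive the bus voltages `x₂, x₅, x₉, x₁₀`. When the driving errors vanish, each of
`x₂, x₅, x₁₀` is a node fed with constant power through a resistor, and the high-voltage
inequalities say that such a node is dissipative (`exists_dissipation_of_high_voltage`). The choice
of `z₇` makes the coupling of these nodes with `x₉` skew, so no small-gain condition arises. A
weighted sum of the quadratic forms of the three levels is the Lyapunov function (`cascade_le`,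
`exists_cascadeForm_decay`). -/

section Development

open Set Filter Metric

/-! ### Forward completeness and Lyapunov's direct method. -/

section Lyapunov

/-- Mean value inequality on a compact interval, with one-sided derivatives at the ends. -/
theorem sub_le_of_hasDerivWithinAt_le {φ : ℝ → ℝ} {a b m : ℝ} (hab : a ≤ b)
    (h : ∀ s ∈ Icc a b, ∃ d ≤ m, HasDerivWithinAt φ d (Icc a b) s) :
    φ b - φ a ≤ m * (b - a) := by
  have hc : ContinuousOn φ (Icc a b) := fun s hs => by
    obtain ⟨d, -, hd⟩ := h s hs
    exact hd.continuousWithinAt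
  have hda : ∀ s ∈ interior (Icc a b), ∃ d ≤ m, HasDerivAt φ d s := fun s hs => by
    obtain ⟨d, hdm, hd⟩ := h s (interior_subset hs)
    exact ⟨d, hdm, hd.hasDerivAt (mem_interior_iff_mem_nhds.1 hs)⟩
  refine (convex_Icc a b).image_sub_le_mul_sub_of_deriv_le hc ?_ ?_ a (left_mem_Icc.2 hab) b
    (right_mem_Icc.2 hab) hab
  · intro s hs
    obtain ⟨d, -, hd⟩ := hda s hs
    exact hd.differentiableAt.differentiableWithinAt
  · intro s hs
    obtain ⟨d, hdm, hd⟩ := hda s hs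
    rwa [hd.deriv]

/-- A bounded, globally Lipschitz vector field is forward complete. -/
theorem exists_isIntegralCurveOn_Ici {E : Type*} [NormedAddCommGroup E] [NormedSpace ℝ E]
    [CompleteSpace E] {g : E → E} {K L : NNReal} (hK : LipschitzWith K g) (hL : ∀ x, ‖g x‖ ≤ L)
    (t₀ : ℝ) (x₀ : E) :
    ∃ γ : ℝ → E, γ t₀ = x₀ ∧ IsIntegralCurveOn γ (fun _ => g) (Ici t₀) := by
  have step : ∀ n : ℕ, ∃ α : ℝ → E, α t₀ = x₀ ∧
      ∀ t ∈ Icc t₀ (t₀ + n), HasDerivWithinAt α (g (α t)) (Icc t₀ (t₀ + n)) t := by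
    intro n
    have h0 : t₀ ∈ Icc t₀ (t₀ + n) := ⟨le_rfl, by simp⟩
    -- A speed of at most `L` keeps the curve in the ball of radius `L n` during time `n`, so one
    -- Picard–Lindelöf application covers the whole interval.
    have := IsPicardLindelof.of_time_independent (f := g) (t₀ := ⟨t₀, h0⟩) (x₀ := x₀)
      (a := L * n) (r := 0) (L := L) (K := K) (fun x _ => hL x) (hK.lipschitzOnWith) (by simp)
    exact this.exists_eq_forall_mem_Icc_hasDerivWithinAt₀
  choose α hα0 hα using step
  have hci : ∀ n : ℕ, ∀ T ≤ t₀ + n, ∀ t ∈ Ico t₀ T,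
      HasDerivWithinAt (α n) (g (α n t)) (Ici t) t := fun n T hT t ht =>
    (hα n t ⟨ht.1, ht.2.le.trans hT⟩).mono_of_mem_nhdsWithin
      (mem_of_superset (Icc_mem_nhdsGE (ht.2.trans_le hT)) (Icc_subset_Icc_left ht.1))
  have hcc : ∀ n : ℕ, ∀ T ≤ t₀ + n, ContinuousOn (α n) (Icc t₀ T) := fun n T hT t ht =>
    (hα n t ⟨ht.1, ht.2.trans hT⟩).continuousWithinAt.mono (Icc_subset_Icc_right hT)
  have huniq : ∀ n m : ℕ, ∀ t, t₀ ≤ t → t ≤ t₀ + n → t ≤ t₀ + m → α n t = α m t := by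
    intro n m t h0 hn hm
    exact ODE_solution_unique (v := fun _ => g) (fun _ => hK) (hcc n t hn) (hci n t hn) (hcc m t hm)
      (hci m t hm) ((hα0 n).trans (hα0 m).symm) ⟨h0, le_rfl⟩
  refine ⟨fun t => α (⌈t - t₀⌉₊) t, by simp [hα0], fun t ht => ?_⟩
  have ht : t₀ ≤ t := ht
  -- The extra 1 puts `t` strictly before the right end of the interval, so that the interval is a
  -- neighbourhood of `t` within `Ici t₀`.
  set N := ⌈t - t₀⌉₊ + 1 with hN
  have hceil : ∀ s, s ≤ t₀ + (⌈s - t₀⌉₊ : ℝ) := fun s => by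
    have := Nat.le_ceil (s - t₀); linarith
  have htN : t < t₀ + (N : ℝ) := by
    have := hceil t
    rw [hN]; push_cast; linarith
  have hev : ∀ s ∈ Icc t₀ (t₀ + (N : ℝ)), α (⌈s - t₀⌉₊) s = α N s := fun s hs =>
    huniq _ _ s hs.1 (hceil s) hs.2
  have hmem : Icc t₀ (t₀ + (N : ℝ)) ∈ 𝓝[Ici t₀] t := by
    rw [mem_nhdsWithin]
    exact ⟨Iio (t₀ + N), isOpen_Iio, htN, fun s hs => ⟨hs.2, le_of_lt hs.1⟩⟩
  have h1 : HasDerivWithinAt (α N) (g (α N t)) (Ici t₀) t :=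
    (hα N t ⟨ht, htN.le⟩).mono_of_mem_nhdsWithin hmem
  have h2 : HasDerivWithinAt (fun s => α (⌈s - t₀⌉₊) s) (g (α N t)) (Ici t₀) t :=
    h1.congr_of_eventuallyEq (mem_of_superset hmem hev) (hev t ⟨ht, htN.le⟩)
  have h3 := hev t ⟨ht, htN.le⟩
  simp only at h3 ⊢
  rwa [h3]

/-- A vector field that is `C¹` at a point agrees near that point with a bounded, globally
Lipschitz one. -/
theorem ContDiffAt.exists_lipschitzWith_bounded_eventuallyEq {E : Type*} [NormedAddCommGroup E]
    [NormedSpace ℝ E] [FiniteDimensional ℝ E] {f : E → E} {x : E} (hf : ContDiffAt ℝ 1 f x) :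
    ∃ (g : E → E) (K L : NNReal), LipschitzWith K g ∧ (∀ y, ‖g y‖ ≤ L) ∧ g =ᶠ[𝓝 x] f := by
  obtain ⟨ρ, hρ, hball⟩ := Metric.eventually_nhds_iff_ball.1 (hf.eventually (by simp))
  -- The cutoff is 1 near `x` and supported where `f` is still `C¹`; the product is therefore `C¹`
  -- with compact support, hence bounded and Lipschitz.
  let χ : ContDiffBump x := ⟨ρ / 4, ρ / 2, by positivity, by linarith⟩
  let g : E → E := fun y => χ y • f y
  have hsupp : tsupport g ⊆ tsupport χ := tsupport_smul_subset_left _ _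
  have hgc : HasCompactSupport g := χ.hasCompactSupport.smul_right
  have hg : ContDiff ℝ 1 g := by
    refine contDiff_iff_contDiffAt.2 fun y => ?_
    by_cases hy : y ∈ tsupport g
    swap
    · exact contDiffAt_const.congr_of_eventuallyEq (notMem_tsupport_iff_eventuallyEq.1 hy)
    have hy := hsupp hy
    rw [χ.tsupport_eq] at hy
    exact χ.contDiffAt.smul (hball y (closedBall_subset_ball (by change ρ / 2 < ρ; linarith) hy))
  obtain ⟨K, hK⟩ := hg.lipschitzWith_of_hasCompactSupport hgc one_ne_zero
  obtain ⟨C, hC⟩ := hgc.exists_bound_of_continuous hg.continuous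
  refine ⟨g, K, C.toNNReal, hK, fun y => (hC y).trans (Real.le_coe_toNNReal C), ?_⟩
  filter_upwards [χ.eventuallyEq_one] with y hy
  simp [g, hy]

variable {E : Type*} [NormedAddCommGroup E]

/-- A Lyapunov function confines curves: a curve along which `V` does not increase inside the
closed ball of radius `ε`, and which starts inside this ball below the minimum of `V` on the
sphere, never leaves the ball. -/
theorem norm_sub_lt_of_nonincreasing {V : E → ℝ} {c : E} {ε μ t₀ t : ℝ} {γ : ℝ → E}
    (h0t : t₀ ≤ t) (hγ : ContinuousOn γ (Icc t₀ t))
    (hV : ∀ s ∈ Icc t₀ t, ‖γ s - c‖ ≤ ε →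
      ∃ d ≤ 0, HasDerivWithinAt (V ∘ γ) d (Icc t₀ t) s)
    (hμ : ∀ x, ‖x - c‖ = ε → μ ≤ V x) (h0 : ‖γ t₀ - c‖ < ε) (hV0 : V (γ t₀) < μ) :
    ‖γ t - c‖ < ε := by
  by_contra! hcon
  have hn : ContinuousOn (fun s => ‖γ s - c‖) (Icc t₀ t) := (hγ.sub continuousOn_const).norm
  obtain ⟨s₁, hs₁, hs₁ε⟩ := intermediate_value_Icc h0t hn ⟨h0.le, hcon⟩
  -- The times spent on the sphere form a compact set. Up to the first such time `τ` the curve is in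
  -- the closed ball, so `V` has not increased, contradicting its lower bound on the sphere.
  let A : Set ℝ := Icc t₀ t ∩ (fun s => ‖γ s - c‖) ⁻¹' {ε}
  have hA : IsCompact A := isCompact_Icc.of_isClosed_subset
    (hn.preimage_isClosed_of_isClosed isClosed_Icc isClosed_singleton) inter_subset_left
  obtain ⟨τ, hτ⟩ := hA.exists_isLeast ⟨s₁, hs₁, hs₁ε⟩
  have hlt : ∀ s ∈ Icc t₀ τ, ‖γ s - c‖ ≤ ε := by
    intro s hs
    by_contra! hs'
    obtain ⟨s₂, hs₂, hs₂ε⟩ := intermediate_value_Icc hs.1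
      (hn.mono (Icc_subset_Icc_right (hs.2.trans hτ.1.1.2))) ⟨h0.le, hs'.le⟩
    have h1 : τ ≤ s₂ := hτ.2 ⟨⟨hs₂.1, hs₂.2.trans (hs.2.trans hτ.1.1.2)⟩, hs₂ε⟩
    have h2 : s₂ = s := le_antisymm hs₂.2 (hs.2.trans h1)
    simp only [h2] at hs₂ε
    exact hs'.ne' hs₂ε
  have hsub : Icc t₀ τ ⊆ Icc t₀ t := Icc_subset_Icc_right hτ.1.1.2
  have hdec := sub_le_of_hasDerivWithinAt_le (φ := V ∘ γ) (m := 0) hτ.1.1.1 fun s hs => by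
    obtain ⟨d, hd, hd'⟩ := hV s (hsub hs) (hlt s hs)
    exact ⟨d, hd, hd'.mono hsub⟩
  have h3 : μ ≤ V (γ τ) := hμ _ hτ.1.2
  simp only [Function.comp] at hdec
  linarith

/-- **Lyapunov's direct method** for a vector field that is `C¹` at the equilibrium. The function
`V` is positive definite, and its derivative along the vector field is bounded by `-N` with `N`
positive definite. -/
theorem asymptoticallyStable_of_lyapunov [NormedSpace ℝ E] [FiniteDimensional ℝ E] {f : E → E}
    {c : E} {V N : E → ℝ} (hf : ContDiffAt ℝ 1 f c)
    (hVc : ∀ᶠ x in 𝓝 c, ContinuousAt V x) (hV0 : V c = 0)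
    (hVpos : ∀ᶠ x in 𝓝 c, x ≠ c → 0 < V x)
    (hNc : ∀ᶠ x in 𝓝 c, ContinuousAt N x) (hN : ∀ᶠ x in 𝓝 c, 0 ≤ N x)
    (hNpos : ∀ᶠ x in 𝓝 c, x ≠ c → 0 < N x)
    (hdec : ∀ᶠ x in 𝓝 c, ∀ (γ : ℝ → E) (s : Set ℝ) (t : ℝ), γ t = x →
      HasDerivWithinAt γ (f x) s t → ∃ d ≤ -N x, HasDerivWithinAt (V ∘ γ) d s t) :
    AsymptoticallyStable (fun _ => f) c := by
  obtain ⟨g, K, L, hgK, hgL, hgf⟩ := hf.exists_lipschitzWith_bounded_eventuallyEq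
  obtain ⟨ρ, hρ, hball⟩ := Metric.eventually_nhds_iff_ball.1
    (hVc.and (hVpos.and (hNc.and (hN.and (hNpos.and (hdec.and hgf))))))
  have hin : ∀ {x : E} {ε : ℝ}, ε < ρ → ‖x - c‖ ≤ ε → x ∈ ball c ρ := fun hε hx => by
    rw [mem_ball, dist_eq_norm]; exact hx.trans_lt hε
  have hcball : ContinuousAt V c := (hball c (mem_ball_self hρ)).1
  -- confinement, for curves that solve the equation as long as they are in the ball
  have key : ∀ ε, 0 < ε → ε < ρ → ∃ δ > 0, δ ≤ ε ∧ ∀ (t₀ t : ℝ) (γ : ℝ → E), t₀ ≤ t →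
      ‖γ t₀ - c‖ < δ → ContinuousOn γ (Icc t₀ t) →
      (∀ s ∈ Icc t₀ t, ‖γ s - c‖ ≤ ε → HasDerivWithinAt γ (f (γ s)) (Icc t₀ t) s) →
      ‖γ t - c‖ < ε := by
    intro ε hε hερ
    have hS : IsCompact (sphere c ε) := isCompact_sphere c ε
    have hVS : ContinuousOn V (sphere c ε) := fun x hx =>
      (hball x (hin hερ (by rw [← dist_eq_norm]; exact le_of_eq hx))).1.continuousWithinAt
    obtain ⟨μ, hμ, hμV⟩ : ∃ μ > 0, ∀ x, ‖x - c‖ = ε → μ ≤ V x := by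
      -- The sphere is empty when the space is trivial; any positive level then serves.
      rcases (sphere c ε).eq_empty_or_nonempty with he | hne
      · refine ⟨1, one_pos, fun x hx => ?_⟩
        have : x ∈ sphere c ε := by rw [mem_sphere, dist_eq_norm]; exact hx
        rw [he] at this; exact this.elim
      · obtain ⟨z, hz, hzmin⟩ := hS.exists_isMinOn hne hVS
        have hzc : z ≠ c := by
          rintro rfl; simp at hz; exact hε.ne hz
        refine ⟨V z, (hball z (hin hερ (by rw [← dist_eq_norm]; exact le_of_eq hz))).2.1 hzc,
          fun x hx => hzmin ?_⟩
        rw [mem_sphere, dist_eq_norm]; exact hx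
    have : ∀ᶠ x in 𝓝 c, V x < μ := hcball.eventually_lt continuousAt_const (by rwa [hV0])
    obtain ⟨δ, hδ, hδV⟩ := Metric.eventually_nhds_iff_ball.1 this
    refine ⟨min δ ε, lt_min hδ hε, min_le_right _ _, fun t₀ t γ h0t hγ0 hγc hγ => ?_⟩
    refine norm_sub_lt_of_nonincreasing (V := V) h0t hγc (fun s hs hsε => ?_) hμV
      (hγ0.trans_le (min_le_right _ _)) (hδV _ ?_)
    · obtain ⟨-, -, -, hN0, -, hd, -⟩ := hball (γ s) (hin hερ hsε)
      obtain ⟨d, hd, hd'⟩ := hd γ _ s rfl (hγ s hs hsε)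
      exact ⟨d, hd.trans (by linarith), hd'⟩
    · rw [mem_ball, dist_eq_norm]
      exact hγ0.trans_le (min_le_left _ _)
  have hIcc : ∀ {γ : ℝ → E} {t₀ t₁ t : ℝ}, t₀ ≤ t₁ → IsIntegralCurveOn γ (fun _ => f) (Ici t₀) →
      ∀ s ∈ Icc t₁ t, HasDerivWithinAt γ (f (γ s)) (Icc t₁ t) s := fun h01 hγ s hs =>
    (hγ s (h01.trans hs.1)).mono fun u hu => h01.trans hu.1
  constructor
  · intro ε hε
    obtain ⟨δ, hδ, -, hkey⟩ := key (min ε (ρ / 2)) (by positivity)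
      ((min_le_right _ _).trans_lt (by linarith))
    refine ⟨δ, hδ, fun t₀ ξ₀ hξ₀ => ⟨?_, fun T γ hγ0 hγ t ht => ?_⟩⟩
    · obtain ⟨γ, hγ0, hγ⟩ := exists_isIntegralCurveOn_Ici hgK hgL t₀ ξ₀
      -- The global solution of the truncated field is confined to a ball where the two fields
      -- agree, so it solves the original equation.
      have hgf' : ∀ x, ‖x - c‖ ≤ min ε (ρ / 2) → g x = f x := fun x hx =>
        (hball x (hin ((min_le_right _ _).trans_lt (by linarith)) hx)).2.2.2.2.2.2
      have hstay : ∀ t ∈ Ici t₀, ‖γ t - c‖ < min ε (ρ / 2) := fun t ht =>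
        hkey t₀ t γ ht (by rwa [hγ0]) (hγ.continuousOn.mono Icc_subset_Ici_self)
          fun s hs hsε => by
            rw [← hgf' _ hsε]
            exact (hγ s hs.1).mono Icc_subset_Ici_self
      refine ⟨γ, hγ0, fun t ht => ?_⟩
      have := hγ t ht
      simp only [hgf' _ (hstay t ht).le] at this
      exact this
    · have hsub : Icc t₀ t ⊆ Ico t₀ T := fun s hs => ⟨hs.1, hs.2.trans_lt ht.2⟩
      exact (hkey t₀ t γ ht.1 (by rwa [hγ0]) (hγ.continuousOn.mono hsub)
        fun s hs _ => (hγ s (hsub hs)).mono hsub).trans_le (min_le_left _ _)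
  · obtain ⟨r, hr, hrρ, hkey⟩ := key (ρ / 2) (by positivity) (by linarith)
    refine ⟨r, hr, fun t₀ ξ₀ hξ₀ γ hγ0 hγ => ?_⟩
    have hstay : ∀ t, t₀ ≤ t → ‖γ t - c‖ < ρ / 2 := fun t ht =>
      hkey t₀ t γ ht (by rwa [hγ0]) (hγ.continuousOn.mono Icc_subset_Ici_self)
        fun s hs _ => hIcc le_rfl hγ s hs
    rw [Metric.tendsto_atTop]
    intro η hη
    obtain ⟨δ, hδ, hδη, hkey'⟩ := key (min η (ρ / 2)) (by positivity)
      ((min_le_right _ _).trans_lt (by linarith))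
    -- By confinement from time `t₁` on, a single visit to the `δ`-ball is enough for convergence.
    suffices h : ∃ t₁, t₀ ≤ t₁ ∧ ‖γ t₁ - c‖ < δ by
      obtain ⟨t₁, h01, ht₁⟩ := h
      refine ⟨t₁, fun t ht => ?_⟩
      rw [dist_eq_norm]
      exact (hkey' t₁ t γ ht ht₁
        (hγ.continuousOn.mono fun s hs => h01.trans hs.1)
        fun s hs _ => hIcc h01 hγ s hs).trans_le (min_le_left _ _)
    -- Otherwise the curve stays in a compact shell away from `c`, where `N` has a positive minimum
    -- `N z`; then `V` would be negative after time `(V (γ t₀) + 1) / N z`.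
    by_contra! hcon
    have hC : IsCompact (closedBall c (ρ / 2) \ ball c δ) := (isCompact_closedBall c _).diff isOpen_ball
    have hmemC : ∀ t, t₀ ≤ t → γ t ∈ closedBall c (ρ / 2) \ ball c δ := fun t ht => by
      refine ⟨?_, ?_⟩
      · rw [mem_closedBall, dist_eq_norm]; exact (hstay t ht).le
      · rw [mem_ball, dist_eq_norm, not_lt]; exact hcon t ht
    have hCball : ∀ x ∈ closedBall c (ρ / 2) \ ball c δ, x ∈ ball c ρ := fun x hx =>
      closedBall_subset_ball (by linarith) hx.1
    obtain ⟨z, hz, hzmin⟩ := hC.exists_isMinOn ⟨_, hmemC t₀ le_rfl⟩ fun x hx =>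
      (hball x (hCball x hx)).2.2.1.continuousWithinAt
    have hzc : z ≠ c := by
      rintro rfl; exact hz.2 (mem_ball_self hδ)
    have hNz : 0 < N z := (hball z (hCball z hz)).2.2.2.2.1 hzc
    have hVnn : ∀ x ∈ ball c ρ, 0 ≤ V x := fun x hx => by
      rcases eq_or_ne x c with rfl | hxc
      · rw [hV0]
      · exact ((hball x hx).2.1 hxc).le
    have hdrop : ∀ t, t₀ ≤ t → V (γ t) - V (γ t₀) ≤ -N z * (t - t₀) := fun t ht =>
      sub_le_of_hasDerivWithinAt_le (φ := V ∘ γ) ht fun s hs => by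
        obtain ⟨d, hd, hd'⟩ := (hball (γ s) (hCball _ (hmemC s hs.1))).2.2.2.2.2.1 γ _ s rfl
          (hIcc le_rfl hγ s hs)
        have : N z ≤ N (γ s) := hzmin (hmemC s hs.1)
        exact ⟨d, hd.trans (by linarith), hd'⟩
    have hV0' : 0 ≤ V (γ t₀) := hVnn _ (hCball _ (hmemC t₀ le_rfl))
    have hlen : t₀ ≤ t₀ + (V (γ t₀) + 1) / N z := by
      have : 0 ≤ (V (γ t₀) + 1) / N z := by positivity
      linarith
    have h1 := hdrop _ hlen
    have h2 := hVnn _ (hCball _ (hmemC _ hlen))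
    have h3 : -N z * (t₀ + (V (γ t₀) + 1) / N z - t₀) = -(V (γ t₀) + 1) := by
      field_simp; ring
    rw [h3] at h1
    linarith

end Lyapunov

/-! ### Steady-state equations. -/

section Balance

/-- The steady-state equations, in terms of the duty cycles `a`, `b`. -/
theorem Microgrid.Grid.Feasible.exists_duty {p : Grid} {r : Reference} (hp : p.Physical)
    (hr : p.Feasible r) : ∃ a b : ℝ, a ∈ Icc (0 : ℝ) 1 ∧
      1 / p.R2 * (r.x9 - r.x2) + (1 - a) * (1 / p.R1 * (p.VPV - r.x1)) = 0 ∧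
      r.x1 - (1 - a) * r.x2
        - (p.R01 * (1 - a) + p.R02 * a) * (1 / p.R1 * (p.VPV - r.x1)) = 0 ∧
      1 / p.R5 * (r.x9 - r.x5) + (1 - b) * (1 / p.R4 * (p.VB - r.x4)) = 0 ∧
      r.x4 - (1 - b) * r.x5 - p.R04 * (1 / p.R4 * (p.VB - r.x4)) = 0 ∧
      1 / p.R2 * (r.x2 - r.x9) + 1 / p.R5 * (r.x5 - r.x9) + 1 / p.R10 * (r.x10 - r.x9)
        - 1 / p.RL * r.x9 = 0 ∧
      -(3 / 2) * (1 / r.x10) * (p.vld * r.x11 + p.vlq * r.x12)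
        + 1 / p.R10 * (r.x9 - r.x10) = 0 := by
  -- Only the equation of `x₈` contains `V_S`, and it is not used, so the value 1 is as good as any
  -- other.
  obtain ⟨u, hu, h⟩ := hr.balance 1 one_pos
  have h1 := congrFun h 1
  have h2 := congrFun h 2
  have h4 := congrFun h 4
  have h5 := congrFun h 5
  have h8 := congrFun h 8
  have h9 := congrFun h 9
  simp only [Grid.field, Grid.equilibrium, Matrix.cons_val, Pi.zero_apply, sub_self, mul_zero,
    zero_add] at h1 h2 h4 h5 h8 h9
  have := hp.C2_pos.ne'
  have := hp.L3_pos.ne'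
  have := hp.C5_pos.ne'
  have := hp.L6_pos.ne'
  have := hp.C9_pos.ne'
  have := hp.C10_pos.ne'
  have := hp.R1_pos.ne'
  have := hp.R2_pos.ne'
  have := hp.R4_pos.ne'
  have := hp.R5_pos.ne'
  have := hp.R10_pos.ne'
  have := hp.RL_pos.ne'
  have := hr.x10_pos.ne'
  refine ⟨u 0, u 1, hu, ?_, ?_, ?_, ?_, ?_, ?_⟩
  · refine Eq.trans ?_ (mul_eq_zero_of_right p.C2 h1); field_simp; ring
  · refine Eq.trans ?_ (mul_eq_zero_of_right p.L3 h2); field_simp; ring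
  · refine Eq.trans ?_ (mul_eq_zero_of_right p.C5 h4); field_simp; ring
  · refine Eq.trans ?_ (mul_eq_zero_of_right p.L6 h5); field_simp; ring
  · refine Eq.trans ?_ (mul_eq_zero_of_right p.C9 h8); field_simp; ring
  · refine Eq.trans ?_ (mul_eq_zero_of_right p.C10 h9); field_simp

end Balance

/-! ### Static feedback: stored energy and its dissipation. -/

section StateFeedback

variable (p : Grid) (r : Reference)

/-- The slope of the references of `x₁₁`, `x₁₂` with respect to `x₁₀`, chosen so as to draw a
constant current from the capacitor `C₁₀`. -/
noncomputable def currentSlope : ℝ :=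
  (p.vld * r.x11 + p.vlq * r.x12) / (r.x10 * (p.vld ^ 2 + p.vlq ^ 2))

/-- The right-hand side of the equation of `x₁₀`. -/
noncomputable def gridVoltageRate (x : State) : ℝ :=
  -(3 / (2 * p.C10)) * (1 / x 9) * (p.vld * x 10 + p.vlq * x 11)
      + 1 / (p.R10 * p.C10) * (x 8 - x 9)

/-- The deviation of `x₁₁` from its `x₁₀`-dependent reference. -/
noncomputable def dError (x : State) : ℝ :=
  x 10 - r.x11 - currentSlope p r * p.vld * (x 9 - r.x10)

/-- The deviation of `x₁₂` from its `x₁₀`-dependent reference. -/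
noncomputable def qError (x : State) : ℝ :=
  x 11 - r.x12 - currentSlope p r * p.vlq * (x 9 - r.x10)

/-- A stabilizing static state feedback with constant duty cycles `a`, `b`. -/
noncomputable def stateFeedback (a b VS : ℝ) (x : State) : Input :=
  ![a, b, 1 / VS * (2 * x 6 - r.x9),
    2 * (1 / x 9) * (p.vld + p.R11 * x 10 - p.freq * x 11
      + p.L11 * (currentSlope p r * p.vld * gridVoltageRate p x - dError p r x)),
    2 * (1 / x 9) * (p.vlq + p.R11 * x 11 + p.freq * x 10
      + p.L11 * (currentSlope p r * p.vlq * gridVoltageRate p x - qError p r x))]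

/-- The stored energy relative to the equilibrium, with weight `M` on the AC currents. -/
noncomputable def storedEnergy (M : ℝ) (x : State) : ℝ :=
  p.C1 / 2 * (x 0 - r.x1) ^ 2 + p.C2 / 2 * (x 1 - r.x2) ^ 2
    + p.L3 / 2 * (x 2 - 1 / p.R1 * (p.VPV - r.x1)) ^ 2
    + p.C4 / 2 * (x 3 - r.x4) ^ 2 + p.C5 / 2 * (x 4 - r.x5) ^ 2
    + p.L6 / 2 * (x 5 - 1 / p.R4 * (p.VB - r.x4)) ^ 2
    + p.C7 / 2 * (x 6 - r.x9) ^ 2 + p.L8 / 2 * (x 7 - 0) ^ 2 + p.C9 / 2 * (x 8 - r.x9) ^ 2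
    + p.C10 / 2 * (x 9 - r.x10) ^ 2 + M / 2 * dError p r x ^ 2 + M / 2 * qError p r x ^ 2

/-- A lower bound for the dissipated power. -/
noncomputable def dissipation (a : ℝ) (x : State) : ℝ :=
  1 / p.R1 * (x 0 - r.x1) ^ 2 + 1 / p.R2 * (x 1 - r.x2 - (x 8 - r.x9)) ^ 2
    + (p.R01 * (1 - a) + p.R02 * a) * (x 2 - 1 / p.R1 * (p.VPV - r.x1)) ^ 2
    + 1 / p.R4 * (x 3 - r.x4) ^ 2 + 1 / p.R5 * (x 4 - r.x5 - (x 8 - r.x9)) ^ 2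
    + p.R04 * (x 5 - 1 / p.R4 * (p.VB - r.x4)) ^ 2
    + 1 / p.R7 * (x 6 - r.x9 - (x 8 - r.x9)) ^ 2 + p.R08 * (x 7 - 0) ^ 2
    + 1 / (2 * p.RL) * (x 8 - r.x9) ^ 2
    + 1 / (2 * p.R10) * (x 9 - r.x10 - (x 8 - r.x9)) ^ 2 + dError p r x ^ 2 + qError p r x ^ 2

variable {p r}

theorem currentSlope_mul (hr : p.Feasible r) :
    currentSlope p r * (p.vld ^ 2 + p.vlq ^ 2) * r.x10 = p.vld * r.x11 + p.vlq * r.x12 := by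
  have := hr.x10_pos.ne'
  unfold currentSlope
  -- Without AC voltage the slope is a division by zero, with value 0, and both sides vanish.
  by_cases h : p.vld ^ 2 + p.vlq ^ 2 = 0
  · have h1 : p.vld = 0 := by nlinarith [sq_nonneg p.vld, sq_nonneg p.vlq]
    have h2 : p.vlq = 0 := by nlinarith [sq_nonneg p.vld, sq_nonneg p.vlq]
    simp [h1, h2]
  · field_simp

theorem hasDerivWithinAt_half_sq {φ : ℝ → ℝ} {φ' w k : ℝ} {s : Set ℝ} {t : ℝ}
    (h : HasDerivWithinAt φ φ' s t) :
    HasDerivWithinAt (fun τ => w / 2 * (φ τ - k) ^ 2) ((φ t - k) * (w * φ')) s t :=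
  (((h.sub_const k).pow 2).const_mul (w / 2)).congr_deriv (by push_cast; ring)

theorem field_stateFeedback {a b VS : ℝ} (hVS : 0 < VS) (x : State) :
    p.field VS (stateFeedback p r a b VS x) x = p.field 1 (stateFeedback p r a b 1 x) x := by
  have : 1 / p.L8 * VS * (1 / VS * (2 * x 6 - r.x9)) =
      1 / p.L8 * 1 * (1 / 1 * (2 * x 6 - r.x9)) := by
    rw [mul_assoc, ← mul_assoc VS, mul_one_div_cancel hVS.ne']; ring
  simp only [Grid.field, stateFeedback, Matrix.cons_val, this]

/-- Young's inequality for the power exchanged between `x₁₀` and the errors of `x₁₁`, `x₁₂`. No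
resistor damps `e` alone, but `e = y + (e - y)` gives `g / 2 * e ^ 2 ≤ g * y ^ 2 + g * (e - y) ^ 2`.
It is applied with half of the load and `R₁₀` conductances; the other halves remain in
`dissipation`. -/
theorem neg_mul_le_of_split {g k c c₁ c₂ : ℝ} (hg : 0 < g) (hk : 0 ≤ k) (hkc : k ≤ c) (h₁ : g ≤ c₁)
    (h₂ : g ≤ c₂) (y e v w d q : ℝ) :
    -(k * e * (v * d + w * q)) ≤
      c₁ * y ^ 2 + c₂ * (e - y) ^ 2 + c ^ 2 / (2 * g) * (v ^ 2 + w ^ 2) * (d ^ 2 + q ^ 2) := by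
  have hP : (v * d + w * q) ^ 2 ≤ (v ^ 2 + w ^ 2) * (d ^ 2 + q ^ 2) := by
    nlinarith [sq_nonneg (v * q - w * d)]
  generalize v * d + w * q = P at *
  have h1 : 0 ≤ g / 2 * (e + k / g * P) ^ 2 := by positivity
  have h2 : g / 2 * (e + k / g * P) ^ 2 =
      g / 2 * e ^ 2 + k * e * P + k ^ 2 / (2 * g) * P ^ 2 := by
    field_simp; ring
  have h3 : k ^ 2 / (2 * g) * P ^ 2 ≤
      c ^ 2 / (2 * g) * ((v ^ 2 + w ^ 2) * (d ^ 2 + q ^ 2)) := by gcongr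
  have h4 : g * y ^ 2 ≤ c₁ * y ^ 2 := by gcongr
  have h5 : g * (e - y) ^ 2 ≤ c₂ * (e - y) ^ 2 := by gcongr
  have h6 : 0 ≤ g * (y - (e - y)) ^ 2 := by positivity
  linarith

/-- Near the equilibrium, the closed loop with `stateFeedback` dissipates the stored energy. -/
theorem dissipation_inequality (hp : p.Physical) (hr : p.Feasible r) {a b : ℝ}
    (h2 : 1 / p.R2 * (r.x9 - r.x2) + (1 - a) * (1 / p.R1 * (p.VPV - r.x1)) = 0)
    (h3 : r.x1 - (1 - a) * r.x2
        - (p.R01 * (1 - a) + p.R02 * a) * (1 / p.R1 * (p.VPV - r.x1)) = 0)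
    (h5 : 1 / p.R5 * (r.x9 - r.x5) + (1 - b) * (1 / p.R4 * (p.VB - r.x4)) = 0)
    (h6 : r.x4 - (1 - b) * r.x5 - p.R04 * (1 / p.R4 * (p.VB - r.x4)) = 0)
    (h9 : 1 / p.R2 * (r.x2 - r.x9) + 1 / p.R5 * (r.x5 - r.x9) + 1 / p.R10 * (r.x10 - r.x9)
        - 1 / p.RL * r.x9 = 0)
    (h10 : -(3 / 2) * (1 / r.x10) * (p.vld * r.x11 + p.vlq * r.x12)
        + 1 / p.R10 * (r.x9 - r.x10) = 0) :
    ∃ M > 0, ∀ x : State, r.x10 / 2 < x 9 →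
      ∀ (γ : ℝ → State) (s : Set ℝ) (t : ℝ), γ t = x →
      HasDerivWithinAt γ (p.field 1 (stateFeedback p r a b 1 x) x) s t →
      ∃ d ≤ -dissipation p r a x, HasDerivWithinAt (storedEnergy p r M ∘ γ) d s t := by
  set g := min (1 / (2 * p.RL)) (1 / (2 * p.R10)) with hg
  have hg0 : 0 < g := lt_min (by have := hp.RL_pos; positivity) (by have := hp.R10_pos; positivity)
  have hx10 := hr.x10_pos
  -- The second summand pays for the cross term, using `3 / (2 x₁₀) ≤ 3 / x₁₀*` when `x₁₀ > x₁₀* /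
  -- 2`; the 1 is what remains as dissipation of the current errors.
  set M := 1 + (3 / r.x10) ^ 2 / (2 * g) * (p.vld ^ 2 + p.vlq ^ 2) with hM
  refine ⟨M, by positivity, fun x hx γ s t hγt hγ => ?_⟩
  have hi := hasDerivWithinAt_pi.1 hγ
  set f := p.field 1 (stateFeedback p r a b 1 x) x with hf
  have := hp.C1_pos
  have := hp.C2_pos
  have := hp.C4_pos
  have := hp.C5_pos
  have := hp.C7_pos
  have := hp.C9_pos
  have := hp.C10_pos
  have := hp.L3_pos
  have := hp.L6_pos
  have := hp.L8_pos
  have := hp.L11_pos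
  have := hp.R1_pos
  have := hp.R2_pos
  have := hp.R4_pos
  have := hp.R5_pos
  have := hp.R7_pos
  have := hp.R10_pos
  have := hp.RL_pos
  have := hr.x10_pos
  have hx9 : 0 < x 9 := by linarith
  -- In the error equations `e0` to `e9` the terms that couple inductors with capacitors occur with
  -- opposite signs and cancel in the energy balance.
  have e0 : p.C1 * f 0 = -(1 / p.R1) * (x 0 - r.x1) - (x 2 - 1 / p.R1 * (p.VPV - r.x1)) := by
    simp only [hf, Grid.field, stateFeedback, Matrix.cons_val]
    field_simp; ring
  have e1 : p.C2 * f 1 = 1 / p.R2 * ((x 8 - r.x9) - (x 1 - r.x2))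
      + (1 - a) * (x 2 - 1 / p.R1 * (p.VPV - r.x1)) := by
    rw [← sub_eq_zero, ← sub_eq_zero.2 h2]
    simp only [hf, Grid.field, stateFeedback, Matrix.cons_val]
    field_simp; ring
  have e2 : p.L3 * f 2 = (x 0 - r.x1) - (1 - a) * (x 1 - r.x2)
      - (p.R01 * (1 - a) + p.R02 * a) * (x 2 - 1 / p.R1 * (p.VPV - r.x1)) := by
    rw [← sub_eq_zero, ← sub_eq_zero.2 h3]
    simp only [hf, Grid.field, stateFeedback, Matrix.cons_val]
    field_simp; ring
  have e3 : p.C4 * f 3 = -(1 / p.R4) * (x 3 - r.x4) - (x 5 - 1 / p.R4 * (p.VB - r.x4)) := by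
    simp only [hf, Grid.field, stateFeedback, Matrix.cons_val]
    field_simp; ring
  have e4 : p.C5 * f 4 = 1 / p.R5 * ((x 8 - r.x9) - (x 4 - r.x5))
      + (1 - b) * (x 5 - 1 / p.R4 * (p.VB - r.x4)) := by
    rw [← sub_eq_zero, ← sub_eq_zero.2 h5]
    simp only [hf, Grid.field, stateFeedback, Matrix.cons_val]
    field_simp; ring
  have e5 : p.L6 * f 5 = (x 3 - r.x4) - (1 - b) * (x 4 - r.x5)
      - p.R04 * (x 5 - 1 / p.R4 * (p.VB - r.x4)) := by
    rw [← sub_eq_zero, ← sub_eq_zero.2 h6]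
    simp only [hf, Grid.field, stateFeedback, Matrix.cons_val]
    field_simp; ring
  have e6 : p.C7 * f 6 = 1 / p.R7 * ((x 8 - r.x9) - (x 6 - r.x9)) - (x 7 - 0) := by
    simp only [hf, Grid.field, stateFeedback, Matrix.cons_val]
    field_simp; ring
  have e7 : p.L8 * f 7 = (x 6 - r.x9) - p.R08 * (x 7 - 0) := by
    simp only [hf, Grid.field, stateFeedback, Matrix.cons_val]
    field_simp; ring
  have e8 : p.C9 * f 8 = 1 / p.R2 * ((x 1 - r.x2) - (x 8 - r.x9))
      + 1 / p.R5 * ((x 4 - r.x5) - (x 8 - r.x9)) + 1 / p.R7 * ((x 6 - r.x9) - (x 8 - r.x9))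
      + 1 / p.R10 * ((x 9 - r.x10) - (x 8 - r.x9)) - 1 / p.RL * (x 8 - r.x9) := by
    rw [← sub_eq_zero, ← sub_eq_zero.2 h9]
    simp only [hf, Grid.field, stateFeedback, Matrix.cons_val]
    field_simp; ring
  have e9 : p.C10 * f 9 = 1 / p.R10 * ((x 8 - r.x9) - (x 9 - r.x10))
      - 3 / 2 * (1 / x 9) * (p.vld * dError p r x + p.vlq * qError p r x) := by
    have hs := currentSlope_mul hr
    -- On the shifted references the AC power is proportional to `x₁₀`; divided by `x₁₀` it is the
    -- constant steady-state current.
    have h10' : p.vld * x 10 + p.vlq * x 11 = p.vld * dError p r x + p.vlq * qError p r x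
        + 1 / r.x10 * (p.vld * r.x11 + p.vlq * r.x12) * x 9 := by
      rw [← hs, dError, qError]
      field_simp; linear_combination -hs
    rw [← sub_eq_zero, ← sub_eq_zero.2 h10]
    simp only [hf, Grid.field, stateFeedback, Matrix.cons_val, h10']
    field_simp; ring
  have e10 : f 10 = currentSlope p r * p.vld * f 9 - dError p r x := by
    have : f 9 = gridVoltageRate p x := rfl
    rw [this]
    simp only [hf, Grid.field, stateFeedback, Matrix.cons_val]
    field_simp; ring
  have e11 : f 11 = currentSlope p r * p.vlq * f 9 - qError p r x := by
    have : f 9 = gridVoltageRate p x := rfl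
    rw [this]
    simp only [hf, Grid.field, stateFeedback, Matrix.cons_val]
    field_simp; ring
  have hd : HasDerivWithinAt (fun τ => dError p r (γ τ)) (-dError p r x) s t :=
    (((hi 10).sub_const r.x11).sub (((hi 9).sub_const r.x10).const_mul
      (currentSlope p r * p.vld))).congr_deriv (by rw [e10]; ring)
  have hq : HasDerivWithinAt (fun τ => qError p r (γ τ)) (-qError p r x) s t :=
    (((hi 11).sub_const r.x12).sub (((hi 9).sub_const r.x10).const_mul
      (currentSlope p r * p.vlq))).congr_deriv (by rw [e11]; ring)
  have hV := (((((((((((hasDerivWithinAt_half_sq (w := p.C1) (k := r.x1) (hi 0)).add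
    (hasDerivWithinAt_half_sq (w := p.C2) (k := r.x2) (hi 1))).add
    (hasDerivWithinAt_half_sq (w := p.L3) (k := 1 / p.R1 * (p.VPV - r.x1)) (hi 2))).add
    (hasDerivWithinAt_half_sq (w := p.C4) (k := r.x4) (hi 3))).add
    (hasDerivWithinAt_half_sq (w := p.C5) (k := r.x5) (hi 4))).add
    (hasDerivWithinAt_half_sq (w := p.L6) (k := 1 / p.R4 * (p.VB - r.x4)) (hi 5))).add
    (hasDerivWithinAt_half_sq (w := p.C7) (k := r.x9) (hi 6))).add
    (hasDerivWithinAt_half_sq (w := p.L8) (k := 0) (hi 7))).add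
    (hasDerivWithinAt_half_sq (w := p.C9) (k := r.x9) (hi 8))).add
    (hasDerivWithinAt_half_sq (w := p.C10) (k := r.x10) (hi 9))).add
    ((hd.pow 2).const_mul (M / 2))).add ((hq.pow 2).const_mul (M / 2))
  refine ⟨_, ?_, hV⟩
  simp only [hγt, e0, e1, e2, e3, e4, e5, e6, e7, e8, e9]
  set k := 3 / 2 * (1 / x 9) with hk
  have hk0 : 0 < k := by positivity
  have hkc : k ≤ 3 / r.x10 := by
    rw [hk, show 3 / r.x10 = 3 / 2 * (1 / (r.x10 / 2)) by field_simp]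
    gcongr
  have hcross := neg_mul_le_of_split hg0 hk0.le hkc (min_le_left _ _ : g ≤ 1 / (2 * p.RL))
    (min_le_right _ _ : g ≤ 1 / (2 * p.R10)) (x 8 - r.x9) (x 9 - r.x10) p.vld p.vlq
    (dError p r x) (qError p r x)
  have hRL : 1 / p.RL = 2 * (1 / (2 * p.RL)) := by field_simp
  have hR10 : 1 / p.R10 = 2 * (1 / (2 * p.R10)) := by field_simp
  rw [dissipation]
  generalize 1 / (2 * p.RL) = c₁ at *
  generalize 1 / (2 * p.R10) = c₂ at *
  rw [hRL, hR10]
  rw [hM]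
  push_cast
  linarith [hcross]

end StateFeedback

/-! ### Static feedback: definiteness, smoothness and stability. -/

section StateFeedback

variable {p : Grid} {r : Reference}

theorem eq_zero_of_weighted_sum_sq_nonpos {ι : Type*} {s : Finset ι} {w e : ι → ℝ}
    (hw : ∀ i ∈ s, 0 < w i) (h : ∑ i ∈ s, w i * e i ^ 2 ≤ 0) : ∀ i ∈ s, e i = 0 := by
  have hnn : ∀ i ∈ s, 0 ≤ w i * e i ^ 2 := fun i hi => mul_nonneg (hw i hi).le (sq_nonneg _)
  intro i hi
  have := (Finset.sum_eq_zero_iff_of_nonneg hnn).1 (h.antisymm (Finset.sum_nonneg hnn)) i hi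
  simpa [(hw i hi).ne'] using this

theorem eq_equilibrium_of_sub_eq_zero {x : State} (h0 : x 0 - r.x1 = 0) (h1 : x 1 - r.x2 = 0)
    (h2 : x 2 - 1 / p.R1 * (p.VPV - r.x1) = 0) (h3 : x 3 - r.x4 = 0) (h4 : x 4 - r.x5 = 0)
    (h5 : x 5 - 1 / p.R4 * (p.VB - r.x4) = 0) (h6 : x 6 - r.x9 = 0) (h7 : x 7 = 0)
    (h8 : x 8 - r.x9 = 0) (h9 : x 9 - r.x10 = 0) (h10 : x 10 - r.x11 = 0)
    (h11 : x 11 - r.x12 = 0) : x = p.equilibrium r := by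
  simp only [one_div] at h2 h5
  refine funext fun i => ?_
  fin_cases i <;> simp [Grid.equilibrium] <;> linarith

theorem storedEnergy_equilibrium {M : ℝ} : storedEnergy p r M (p.equilibrium r) = 0 := by
  simp [storedEnergy, dError, qError, Grid.equilibrium]

theorem storedEnergy_pos (hp : p.Physical) {M : ℝ} (hM : 0 < M) {x : State}
    (hx : x ≠ p.equilibrium r) : 0 < storedEnergy p r M x := by
  by_contra! h
  have := hp.C1_pos
  have := hp.C2_pos
  have := hp.C4_pos
  have := hp.C5_pos
  have := hp.C7_pos
  have := hp.C9_pos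
  have := hp.C10_pos
  have := hp.L3_pos
  have := hp.L6_pos
  have := hp.L8_pos
  have key := eq_zero_of_weighted_sum_sq_nonpos (s := Finset.univ)
    (w := ![p.C1 / 2, p.C2 / 2, p.L3 / 2, p.C4 / 2, p.C5 / 2, p.L6 / 2, p.C7 / 2, p.L8 / 2,
      p.C9 / 2, p.C10 / 2, M / 2, M / 2])
    (e := ![x 0 - r.x1, x 1 - r.x2, x 2 - 1 / p.R1 * (p.VPV - r.x1), x 3 - r.x4, x 4 - r.x5,
      x 5 - 1 / p.R4 * (p.VB - r.x4), x 6 - r.x9, x 7 - 0, x 8 - r.x9, x 9 - r.x10,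
      dError p r x, qError p r x])
    (fun i _ => by fin_cases i <;> simp <;> positivity)
    (by
      simp only [Fin.sum_univ_succ, Fin.sum_univ_zero, Matrix.cons_val_zero, Matrix.cons_val_succ]
      unfold storedEnergy at h
      linarith)
  simp only [Finset.mem_univ, true_imp_iff, Fin.forall_fin_succ, Matrix.cons_val_zero,
    Matrix.cons_val_succ, IsEmpty.forall_iff, dError, qError] at key
  obtain ⟨h0, h1, h2, h3, h4, h5, h6, h7, h8, h9, h10, h11, -⟩ := key
  -- The references of `x₁₁`, `x₁₂` return to their nominal values once the error of `x₁₀` is zero.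
  rw [h9] at h10 h11
  exact hx (eq_equilibrium_of_sub_eq_zero h0 h1 h2 h3 h4 h5 h6 (by linarith) h8 h9 (by linarith)
    (by linarith))

theorem dissipation_nonneg_and_pos (hp : p.Physical) {a : ℝ} (ha : a ∈ Icc (0 : ℝ) 1) (x : State) :
    0 ≤ dissipation p r a x ∧ (x ≠ p.equilibrium r → 0 < dissipation p r a x) := by
  have := hp.R1_pos
  have := hp.R2_pos
  have := hp.R4_pos
  have := hp.R5_pos
  have := hp.R7_pos
  have := hp.R10_pos
  have := hp.RL_pos
  have := hp.R04_pos
  have := hp.R08_pos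
  -- A convex combination of two positive resistances; this is where the duty cycle must lie in `[0,
  -- 1]`.
  have hρ : 0 < p.R01 * (1 - a) + p.R02 * a := by
    have h1 := hp.R01_pos
    have h2 := hp.R02_pos
    rcases ha.1.eq_or_lt with rfl | h0
    · simpa using h1
    · have := mul_nonneg h1.le (sub_nonneg.2 ha.2)
      positivity
  refine ⟨by unfold dissipation; positivity, fun hx => ?_⟩
  by_contra! h
  have key := eq_zero_of_weighted_sum_sq_nonpos (s := Finset.univ)
    (w := ![1 / p.R1, 1 / p.R2, p.R01 * (1 - a) + p.R02 * a, 1 / p.R4, 1 / p.R5, p.R04, 1 / p.R7,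
      p.R08, 1 / (2 * p.RL), 1 / (2 * p.R10), 1, 1])
    (e := ![x 0 - r.x1, x 1 - r.x2 - (x 8 - r.x9), x 2 - 1 / p.R1 * (p.VPV - r.x1), x 3 - r.x4,
      x 4 - r.x5 - (x 8 - r.x9), x 5 - 1 / p.R4 * (p.VB - r.x4), x 6 - r.x9 - (x 8 - r.x9),
      x 7 - 0, x 8 - r.x9, x 9 - r.x10 - (x 8 - r.x9), dError p r x, qError p r x])
    (fun i _ => by fin_cases i <;> simp <;> positivity)
    (by
      simp only [Fin.sum_univ_succ, Fin.sum_univ_zero, Matrix.cons_val_zero, Matrix.cons_val_succ]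
      unfold dissipation at h
      linarith)
  simp only [Finset.mem_univ, true_imp_iff, Fin.forall_fin_succ, Matrix.cons_val_zero,
    Matrix.cons_val_succ, IsEmpty.forall_iff, dError, qError] at key
  obtain ⟨h0, h1, h2, h3, h4, h5, h6, h7, h8, h9, h10, h11, -⟩ := key
  -- The load makes the error of `x₉` vanish, after which the line resistors make those of its
  -- neighbours vanish.
  have h9' : x 9 - r.x10 = 0 := by linarith
  rw [h9'] at h10 h11
  exact hx (eq_equilibrium_of_sub_eq_zero h0 (by linarith) h2 h3 (by linarith) h5 (by linarith)
    (by linarith) h8 h9' (by linarith) (by linarith))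

theorem contDiffOn_stateFeedback (a b : ℝ) :
    ContDiffOn ℝ ∞ (fun q : ℝ × State => stateFeedback p r a b q.1 q.2)
      (Ioi 0 ×ˢ {x | 0 < x 9}) := by
  have h1 : ∀ q ∈ (Ioi 0 ×ˢ {x | 0 < x 9} : Set (ℝ × State)), q.1 ≠ 0 := fun q hq => ne_of_gt hq.1
  have h2 : ∀ q ∈ (Ioi 0 ×ˢ {x | 0 < x 9} : Set (ℝ × State)), q.2 9 ≠ 0 := fun q hq => ne_of_gt hq.2
  refine contDiffOn_pi.2 fun i => ?_
  fin_cases i <;>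
    simp only [stateFeedback, gridVoltageRate, dError, qError, Fin.isValue, Fin.reduceFinMk,
      Fin.zero_eta, Fin.mk_one, Matrix.cons_val]
  all_goals fun_prop (disch := assumption)

theorem contDiffAt_stateFeedback_field (a b : ℝ) {c : State} (hc : 0 < c 9) :
    ContDiffAt ℝ 1 (fun x => p.field 1 (stateFeedback p r a b 1 x) x) c := by
  have h2 : c 9 ≠ 0 := hc.ne'
  refine contDiffAt_pi.2 fun i => ?_
  fin_cases i <;>
    simp only [Grid.field, stateFeedback, gridVoltageRate, dError, qError, Fin.isValue,
      Fin.reduceFinMk, Fin.zero_eta, Fin.mk_one, Matrix.cons_val]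
  all_goals fun_prop (disch := assumption)

/-- A smooth static state feedback stabilizes the equilibrium. -/
theorem exists_smooth_stabilizing_stateFeedback (hp : p.Physical) (hr : p.Feasible r) :
    ∃ u : ℝ → State → Input,
      (∃ U ∈ 𝓝 (p.equilibrium r),
        ContDiffOn ℝ ∞ (fun q : ℝ × State => u q.1 q.2) (Set.Ioi 0 ×ˢ U)) ∧
      ∀ VS : ℝ → ℝ, (∀ t, 0 < VS t) →
        AsymptoticallyStable (fun t x => p.field (VS t) (u (VS t) x) x) (p.equilibrium r) := by
  obtain ⟨a, b, ha, h2, h3, h5, h6, h9, h10⟩ := hr.exists_duty hp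
  obtain ⟨M, hM, hdec⟩ := dissipation_inequality hp hr h2 h3 h5 h6 h9 h10
  have hx9 : (p.equilibrium r) 9 = r.x10 := rfl
  have hcont : Continuous fun x : State => x 9 := continuous_apply 9
  refine ⟨stateFeedback p r a b, ⟨{x | 0 < x 9}, ?_, contDiffOn_stateFeedback a b⟩,
    fun VS hVS => ?_⟩
  · exact (isOpen_lt continuous_const hcont).mem_nhds (by simpa [hx9] using hr.x10_pos)
  have hfield : (fun t x => p.field (VS t) (stateFeedback p r a b (VS t) x) x) =
      fun _ x => p.field 1 (stateFeedback p r a b 1 x) x :=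
    funext fun t => funext fun x => field_stateFeedback (hVS t) x
  rw [hfield]
  have hnear : ∀ᶠ x in 𝓝 (p.equilibrium r), r.x10 / 2 < x 9 :=
    (isOpen_lt continuous_const hcont).mem_nhds (by
      have := hr.x10_pos
      change r.x10 / 2 < r.x10
      linarith)
  refine asymptoticallyStable_of_lyapunov (V := storedEnergy p r M) (N := dissipation p r a)
    (contDiffAt_stateFeedback_field a b (by rw [hx9]; exact hr.x10_pos))
    (.of_forall fun x => ?_) storedEnergy_equilibrium (.of_forall fun x => storedEnergy_pos hp hM)
    (.of_forall fun x => ?_) (.of_forall fun x => (dissipation_nonneg_and_pos hp ha x).1)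
    (.of_forall fun x => (dissipation_nonneg_and_pos hp ha x).2)
    (hnear.mono fun x hx => hdec x hx)
  · unfold storedEnergy dError qError; fun_prop
  · unfold dissipation dError qError; fun_prop

end StateFeedback

/-! ### The explicit laws: gains, references and regularity. -/

section Backstepping

variable (p : Grid) (r : Reference)

/-- Gains for which all tracking errors decay. -/
noncomputable def trackingGains : Gains where
  K1 := 1 + 1 / (p.R1 * p.C1)
  Kb1 := 1
  Ka1 := 1
  -- The law `v₁` leaves uncompensated the contribution of the `x₃` error to the derivative of `z₃`,
  -- which lowers the damping by `K₁ - 1 / (R₁ C₁) = 1`. With `K₃ = 2` the net damping is 1;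
  -- likewise for `K₆`.
  K3 := 2
  Kb3 := 1
  Ka3 := 1
  K4 := 1 + 1 / (p.R4 * p.C4)
  Kb4 := 1
  Ka4 := 1
  K6 := 2
  Kb6 := 1
  Ka6 := 1
  K11 := 1
  Kb11 := 1
  Ka11 := 1
  K12 := 1
  Kb12 := 1
  Ka12 := 1
  K7 := 1
  K8 := 1

theorem trackingGains_positive (hp : p.Physical) : (trackingGains p).Positive := by
  have := hp.R1_pos
  have := hp.C1_pos
  have := hp.R4_pos
  have := hp.C4_pos
  constructor <;> simp only [trackingGains] <;> positivity

/-- The reference for `x₇`, which makes the interconnection of `x₂, x₅, x₉, x₁₀`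
skew-symmetric. -/
noncomputable def busReference (q : ℝ × ℝ × ℝ × ℝ) : ℝ :=
  -- The converters inject the errors into the bus with coefficient `+1 / R`; the factor 2 turns
  -- this into `-1 / R`, opposite to the effect of the error of `x₉` on each converter.
  r.x9 - 2 * p.R7 * (1 / p.R2 * (q.1 - r.x2) + 1 / p.R5 * (q.2.1 - r.x5)
    + 1 / p.R10 * (q.2.2.2 - r.x10))

theorem contDiff_busReference : ContDiff ℝ ∞ (busReference p r) := by
  unfold busReference; fun_prop

/-- The closed loop, up to the multiple of `e₈` that `u₃` contributes. -/
noncomputable def drift (k : Gains) (ξ : State × Integrators) : State × Integrators :=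
  loopField p r k (fun _ _ => 0) 0 ξ

variable {p r}

theorem loopField_eq_drift_add (k : Gains) (w : ℝ → State × Integrators → ℝ) (VS : ℝ)
    (ξ : State × Integrators) :
    loopField p r k w VS ξ =
      drift p r k ξ + (1 / p.L8 * (VS * w VS ξ)) • ((Pi.single 7 1, 0) : State × Integrators) := by
  refine Prod.ext (funext fun i => ?_) (by simp [drift, loopField])
  simp only [drift, loopField, Prod.fst_add, Prod.smul_fst, Pi.add_apply, Pi.smul_apply,
    Pi.single_apply, smul_eq_mul]
  fin_cases i <;> simp [Grid.field]
  ring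

theorem loopField_u3 (k : Gains) (z7 : ℝ × ℝ × ℝ × ℝ → ℝ) {VS : ℝ} (hVS : 0 < VS)
    (ξ : State × Integrators) :
    loopField p r k (u3 p r k z7) VS ξ = loopField p r k (u3 p r k z7) 1 ξ := by
  rw [loopField_eq_drift_add, loopField_eq_drift_add]
  have : VS * u3 p r k z7 VS ξ = 1 * u3 p r k z7 1 ξ := by
    simp only [u3]
    rw [← mul_assoc, mul_one_div_cancel hVS.ne', one_div_one, one_mul, one_mul]
  rw [this]

theorem hasFDerivAt_coord (i : Fin 12) (ξ : State × Integrators) :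
    HasFDerivAt (fun ξ : State × Integrators => ξ.1 i)
      ((ContinuousLinearMap.proj i).comp (ContinuousLinearMap.fst ℝ State Integrators)) ξ :=
  ((ContinuousLinearMap.proj (R := ℝ) (φ := fun _ : Fin 12 => ℝ) i).comp
    (ContinuousLinearMap.fst ℝ State Integrators)).hasFDerivAt

theorem fderiv_ref7_busReference (ξ v : State × Integrators) :
    fderiv ℝ (ref7 (busReference p r)) ξ v =
      -(2 * p.R7 * (1 / p.R2 * v.1 1 + 1 / p.R5 * v.1 4 + 1 / p.R10 * v.1 9)) := by
  have h := (((((hasFDerivAt_coord 1 ξ).sub_const r.x2).const_mul (1 / p.R2)).add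
    (((hasFDerivAt_coord 4 ξ).sub_const r.x5).const_mul (1 / p.R5))).add
    (((hasFDerivAt_coord 9 ξ).sub_const r.x10).const_mul (1 / p.R10))).const_mul (2 * p.R7)
      |>.const_sub r.x9
  have h' : HasFDerivAt (ref7 (busReference p r)) _ ξ := h
  rw [h'.fderiv]
  simp
  ring

theorem ref8_busReference (k : Gains) (ξ : State × Integrators) :
    ref8 p r k (busReference p r) ξ =
      1 / p.R7 * (ξ.1 8 - ξ.1 6) + p.C7 * k.K7 * (ξ.1 6 - ref7 (busReference p r) ξ)
        + p.C7 * (2 * p.R7 * (1 / p.R2 * (drift p r k ξ).1 1 + 1 / p.R5 * (drift p r k ξ).1 4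
          + 1 / p.R10 * (drift p r k ξ).1 9)) := by
  rw [ref8, dot, fderiv_ref7_busReference]
  simp only [drift]
  ring

/-- Neither `z₇` nor the rates of `x₂`, `x₅`, `x₁₀` contain `x₈`. This legitimates `dot` for `z₈`:
`u₃` acts only in the direction of `x₈`, along which `z₈` is constant. -/
theorem ref8_add_single (k : Gains) (ξ : State × Integrators) (t : ℝ) :
    ref8 p r k (busReference p r) (ξ + t • ((Pi.single 7 1, 0) : State × Integrators)) =
      ref8 p r k (busReference p r) ξ := by
  simp [ref8_busReference, ref7, drift, loopField, Grid.field, u1, u2, v1, v2, z3, z6]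

/-- The states at which the denominators in the control laws are positive. -/
def RegularAt (p : Grid) (ξ : State × Integrators) : Prop :=
  0 < ξ.1 1 + (p.R01 - p.R02) * ξ.1 2 ∧ 0 < ξ.1 4 ∧ 0 < ξ.1 9

theorem isOpen_regularAt : IsOpen {ξ | RegularAt p ξ} := by
  have h1 : Continuous fun ξ : State × Integrators => ξ.1 1 + (p.R01 - p.R02) * ξ.1 2 := by fun_prop
  have h2 : Continuous fun ξ : State × Integrators => ξ.1 4 := by fun_prop
  have h3 : Continuous fun ξ : State × Integrators => ξ.1 9 := by fun_prop
  exact (isOpen_lt continuous_const h1).inter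
    ((isOpen_lt continuous_const h2).inter (isOpen_lt continuous_const h3))

theorem contDiffAt_drift (k : Gains) {ξ : State × Integrators} (h : RegularAt p ξ) :
    ContDiffAt ℝ ∞ (drift p r k) ξ := by
  obtain ⟨h1, h2, h3⟩ := h
  have h1 := h1.ne'
  have h2 := h2.ne'
  have h3 := h3.ne'
  refine ContDiffAt.prodMk (contDiffAt_pi.2 fun i => ?_) (contDiffAt_pi.2 fun i => ?_)
  · fin_cases i <;>
      simp only [Grid.field, u1, u2, u4, u5, v1, v2, z3, z6, Fin.isValue,
        Fin.reduceFinMk, Fin.zero_eta, Fin.mk_one, Matrix.cons_val]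
    all_goals fun_prop (disch := assumption)
  · fin_cases i <;>
      simp only [integratorField, z3, z6, Fin.isValue,
        Fin.reduceFinMk, Fin.zero_eta, Fin.mk_one, Matrix.cons_val]
    all_goals fun_prop

theorem contDiffAt_ref8 (k : Gains) {ξ : State × Integrators} (h : RegularAt p ξ) :
    ContDiffAt ℝ ∞ (ref8 p r k (busReference p r)) ξ := by
  have hd : ∀ i, ContDiffAt ℝ ∞ (fun ξ => (drift p r k ξ).1 i) ξ := fun i =>
    contDiffAt_pi.1 (contDiffAt_drift k h).fst i
  have key : ∀ d₁ d₄ d₉ : State × Integrators → ℝ, ContDiffAt ℝ ∞ d₁ ξ → ContDiffAt ℝ ∞ d₄ ξ →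
      ContDiffAt ℝ ∞ d₉ ξ → ContDiffAt ℝ ∞ (fun ξ => 1 / p.R7 * (ξ.1 8 - ξ.1 6)
        + p.C7 * k.K7 * (ξ.1 6 - ref7 (busReference p r) ξ)
        + p.C7 * (2 * p.R7 * (1 / p.R2 * d₁ ξ + 1 / p.R5 * d₄ ξ + 1 / p.R10 * d₉ ξ))) ξ := by
    intro d₁ d₄ d₉ h₁ h₄ h₉
    unfold ref7 busReference
    fun_prop
  rw [funext (ref8_busReference (p := p) (r := r) k)]
  exact key _ _ _ (hd 1) (hd 4) (hd 9)

theorem contDiffAt_loopField (k : Gains) {ξ : State × Integrators} (h : RegularAt p ξ) :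
    ContDiffAt ℝ 1 (loopField p r k (u3 p r k (busReference p r)) 1) ξ := by
  have hd := (contDiffAt_drift (r := r) k h).of_le (m := 1) (by exact_mod_cast le_top)
  have hz := contDiffAt_ref8 (r := r) k h
  have hz1 := hz.of_le (m := 1) (by exact_mod_cast le_top)
  have hdot : ContDiffAt ℝ 1 (dot p r k (ref8 p r k (busReference p r))) ξ :=
    (hz.fderiv_right (m := 1) (WithTop.coe_le_coe.2 le_top)).clm_apply hd
  rw [funext (loopField_eq_drift_add (p := p) (r := r) k _ 1)]
  have hu : ContDiffAt ℝ 1 (u3 p r k (busReference p r) 1) ξ := by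
    unfold u3; fun_prop
  fun_prop

/-- Along the closed loop, `dot` computes the time derivative of the reference of `x₈`. -/
theorem fderiv_ref8_loopField (k : Gains) (w : ℝ → State × Integrators → ℝ) (VS : ℝ)
    {ξ : State × Integrators} (h : RegularAt p ξ) :
    fderiv ℝ (ref8 p r k (busReference p r)) ξ (loopField p r k w VS ξ) =
      dot p r k (ref8 p r k (busReference p r)) ξ := by
  have hz : HasFDerivAt (ref8 p r k (busReference p r)) _ ξ :=
    ((contDiffAt_ref8 k h).differentiableAt (by simp)).hasFDerivAt
  have h0 : fderiv ℝ (ref8 p r k (busReference p r)) ξ (Pi.single 7 1, 0) = 0 := by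
    have hl := hz.hasLineDerivAt ((Pi.single 7 1, 0) : State × Integrators)
    have hc : HasLineDerivAt ℝ (ref8 p r k (busReference p r)) 0 ξ
        ((Pi.single 7 1, 0) : State × Integrators) := by
      rw [HasLineDerivAt]
      simp_rw [ref8_add_single]
      exact hasDerivAt_const _ _
    exact hl.lineDeriv.symm.trans hc.lineDeriv
  rw [loopField_eq_drift_add, map_add, map_smul, h0, smul_zero, add_zero]
  rfl

end Backstepping

/-! ### Scalar estimates: constant-power nodes and integral action. -/

section Estimates

/-- A `C¹` function vanishing at `0` is bounded by a multiple of the Euclidean norm. -/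
theorem exists_sq_le_mul_sum_sq {n : ℕ} {Q : (Fin n → ℝ) → ℝ} (hQ : ContDiffAt ℝ 1 Q 0)
    (h0 : Q 0 = 0) : ∃ K ≥ 0, ∀ᶠ y in 𝓝 0, Q y ^ 2 ≤ K * ∑ i, y i ^ 2 := by
  obtain ⟨K, t, ht, hK⟩ := hQ.exists_lipschitzOnWith
  refine ⟨(K : ℝ) ^ 2, by positivity, mem_of_superset ht fun y hy => ?_⟩
  have h1 : |Q y| ≤ K * ‖y‖ := by
    have := hK.norm_sub_le hy (mem_of_mem_nhds ht)
    simpa [h0] using this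
  have h2 : ‖y‖ ≤ √(∑ i, y i ^ 2) := by
    refine (pi_norm_le_iff_of_nonneg (Real.sqrt_nonneg _)).2 fun i => ?_
    rw [Real.norm_eq_abs, ← Real.sqrt_sq_eq_abs]
    exact Real.sqrt_le_sqrt (Finset.single_le_sum (f := fun i => y i ^ 2)
      (fun i _ => sq_nonneg _) (Finset.mem_univ i))
  calc Q y ^ 2 = |Q y| ^ 2 := (sq_abs _).symm
    _ ≤ (K * √(∑ i, y i ^ 2)) ^ 2 := by gcongr; exact h1.trans (by gcongr)
    _ = K ^ 2 * ∑ i, y i ^ 2 := by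
      rw [mul_pow, Real.sq_sqrt (Finset.sum_nonneg fun i _ => sq_nonneg _)]

/-- Dissipation at a node fed by a constant power source through a resistance `R`, on the
high-voltage branch: the current `(ν d + n) / (d + δ + e)` is perturbed by `n` and `δ`. -/
theorem exists_dissipation_of_high_voltage {R d x v : ℝ} (hR : 0 < R) (hd : 0 < d)
    (hhigh : v < d + x) :
    ∃ c > 0, ∃ B ≥ 0, ∃ ρ > 0, ∀ e n δ : ℝ, |e| < ρ → |δ| < ρ →
      e * (-(1 / R) * e + ((1 / R * (x - v) * d + n) / (d + δ + e) - 1 / R * (x - v))) ≤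
        -c * e ^ 2 + B * (n ^ 2 + δ ^ 2) := by
  set ν := 1 / R * (x - v) with hν
  set η := d + x - v with hη
  have hη0 : 0 < η := by rw [hη]; linarith
  -- For `|e|, |δ| < min d η / 4` one has `D < 3 d / 2` and `ν R + D > η / 2`, so the damping is at
  -- least `η / (3 d R) = 2 c`; half of it is spent in Young's inequality.
  set c := η / (6 * d * R) with hc
  have hc0 : 0 < c := by positivity
  refine ⟨c, hc0, 2 / (c * d ^ 2) * (1 + ν ^ 2), by positivity, min d η / 4, by positivity,
    fun e n δ he hδ => ?_⟩
  have he' := abs_lt.1 he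
  have hδ' := abs_lt.1 hδ
  have hm1 := min_le_left d η
  have hm2 := min_le_right d η
  set D := d + δ + e with hD
  have hD1 : d / 2 < D := by rw [hD]; linarith
  have hD2 : D < 3 / 2 * d := by rw [hD]; linarith
  have hD0 : 0 < D := by linarith
  have hν' : ν * R = x - v := by rw [hν]; field_simp
  have hexp : e * (-(1 / R) * e + ((ν * d + n) / D - ν)) =
      -((ν * R + D) / (R * D)) * e ^ 2 + e * ((n - ν * δ) / D) := by
    field_simp
    rw [hD]; ring
  have hcoef : 2 * c ≤ (ν * R + D) / (R * D) := by
    have h1 : η / 2 ≤ ν * R + D := by rw [hν', hD]; linarith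
    have h2 : 0 ≤ ν * R + D := by linarith
    calc 2 * c = (η / 2) / (R * (3 / 2 * d)) := by rw [hc]; field_simp; norm_num
      _ ≤ _ := by gcongr
  have hyoung : e * ((n - ν * δ) / D) ≤ c * e ^ 2 + 1 / (4 * c) * ((n - ν * δ) / D) ^ 2 := by
    have h1 : 0 ≤ c * (e - 1 / (2 * c) * ((n - ν * δ) / D)) ^ 2 := by positivity
    have h2 : c * (e - 1 / (2 * c) * ((n - ν * δ) / D)) ^ 2 = c * e ^ 2
        - e * ((n - ν * δ) / D) + 1 / (4 * c) * ((n - ν * δ) / D) ^ 2 := by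
      generalize (n - ν * δ) / D = q
      field_simp; ring
    linarith
  have hpert : 1 / (4 * c) * ((n - ν * δ) / D) ^ 2 ≤
      2 / (c * d ^ 2) * (1 + ν ^ 2) * (n ^ 2 + δ ^ 2) := by
    have h1 : (n - ν * δ) ^ 2 ≤ 2 * ((1 + ν ^ 2) * (n ^ 2 + δ ^ 2)) := by
      nlinarith [sq_nonneg (n + ν * δ), sq_nonneg (ν * n), sq_nonneg δ]
    calc 1 / (4 * c) * ((n - ν * δ) / D) ^ 2 = 1 / (4 * c) * ((n - ν * δ) ^ 2 / D ^ 2) := by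
          rw [div_pow]
      _ ≤ 1 / (4 * c) * (2 * ((1 + ν ^ 2) * (n ^ 2 + δ ^ 2)) / (d / 2) ^ 2) := by gcongr
      _ = _ := by field_simp; norm_num
  have := mul_le_mul_of_nonneg_right hcoef (sq_nonneg e)
  rw [hexp]
  linarith

/-- A quadratic Lyapunov function for a tracking error `e` with integral action `a`. -/
noncomputable def integralForm (κ e a : ℝ) : ℝ := e ^ 2 + e * a + (1 + κ / 2) * a ^ 2

theorem le_integralForm {κ : ℝ} (hκ : 0 ≤ κ) (e a : ℝ) :
    1 / 2 * e ^ 2 + 1 / 2 * a ^ 2 ≤ integralForm κ e a := by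
  unfold integralForm
  nlinarith [sq_nonneg (e + a), mul_nonneg hκ (sq_nonneg a)]

/-- The cross term `e * a` of the form produces the damping `-a ^ 2`, and the coefficient `1 + κ /
2` is the one for which the mixed terms cancel. -/
theorem hasDerivWithinAt_integralForm {κ d : ℝ} {e a : ℝ → ℝ} {s : Set ℝ} {t : ℝ}
    (he : HasDerivWithinAt e (-κ * e t - a t + d) s t) (ha : HasDerivWithinAt a (e t) s t) :
    HasDerivWithinAt (fun τ => integralForm κ (e τ) (a τ))
      (-(2 * κ - 1) * e t ^ 2 - a t ^ 2 + (2 * e t + a t) * d) s t :=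
  (((he.pow 2).add (he.mul ha)).add ((ha.pow 2).const_mul (1 + κ / 2))).congr_deriv
    (by push_cast; ring)

end Estimates

/-! ### The closed loop in error coordinates. -/

section ErrorDynamics

variable {p : Grid} {r : Reference} {k : Gains} {w : ℝ → State × Integrators → ℝ} {VS : ℝ}
  {ξ : State × Integrators}

theorem loopField_x1 (hp : p.Physical) : (loopField p r k w VS ξ).1 0 =
    -k.K1 * (ξ.1 0 - r.x1) - k.Kb1 * ξ.2 0
      - 1 / p.C1 * (ξ.1 2 - z3 p r k (ξ.1 0) (ξ.2 0)) := by
  have := hp.C1_pos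
  have := hp.R1_pos
  simp only [loopField, Grid.field, z3, Matrix.cons_val]
  field_simp; ring

theorem loopField_x4 (hp : p.Physical) : (loopField p r k w VS ξ).1 3 =
    -k.K4 * (ξ.1 3 - r.x4) - k.Kb4 * ξ.2 2
      - 1 / p.C4 * (ξ.1 5 - z6 p r k (ξ.1 3) (ξ.2 2)) := by
  have := hp.C4_pos
  have := hp.R4_pos
  simp only [loopField, Grid.field, z6, Matrix.cons_val]
  field_simp; ring

theorem loopField_x3 (hp : p.Physical) (h : RegularAt p ξ) : (loopField p r k w VS ξ).1 2 =
    -v1 p r k (ξ.1 0) (ξ.1 2) (ξ.2 0) (ξ.2 1) := by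
  have := hp.L3_pos
  have hD0 := h.1
  simp only [loopField, Grid.field, u1, Matrix.cons_val]
  obtain ⟨D, hD⟩ : ∃ D, D = ξ.1 1 + (p.R01 - p.R02) * ξ.1 2 := ⟨_, rfl⟩
  rw [← hD] at hD0 ⊢
  rw [show ξ.1 1 = D - (p.R01 - p.R02) * ξ.1 2 by rw [hD]; ring]
  field_simp; ring

theorem loopField_x6 (hp : p.Physical) (h : RegularAt p ξ) : (loopField p r k w VS ξ).1 5 =
    v2 p r k (ξ.1 3) (ξ.1 5) (ξ.2 2) (ξ.2 3) := by
  have := hp.L6_pos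
  have := h.2.1
  simp only [loopField, Grid.field, u2, Matrix.cons_val]
  field_simp; ring

theorem loopField_x11 (hp : p.Physical) (h : RegularAt p ξ) : (loopField p r k w VS ξ).1 10 =
    -k.K11 * (ξ.1 10 - r.x11) - k.Kb11 * ξ.2 4 := by
  have := hp.L11_pos
  have := h.2.2
  simp only [loopField, Grid.field, u4, Matrix.cons_val]
  field_simp; ring

theorem loopField_x12 (hp : p.Physical) (h : RegularAt p ξ) : (loopField p r k w VS ξ).1 11 =
    -k.K12 * (ξ.1 11 - r.x12) - k.Kb12 * ξ.2 5 := by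
  have := hp.L11_pos
  have := h.2.2
  simp only [loopField, Grid.field, u5, Matrix.cons_val]
  field_simp; ring

theorem loopField_x7 (hp : p.Physical) : (loopField p r k w VS ξ).1 6 =
    1 / p.C7 * (1 / p.R7 * (ξ.1 8 - ξ.1 6) - ξ.1 7) := by
  have := hp.C7_pos
  have := hp.R7_pos
  simp only [loopField, Grid.field, Matrix.cons_val]
  field_simp; ring

theorem loopField_x8 (hp : p.Physical) (z7 : ℝ × ℝ × ℝ × ℝ → ℝ) :
    (loopField p r k (u3 p r k z7) 1 ξ).1 7 =
      dot p r k (ref8 p r k z7) ξ - k.K8 * (ξ.1 7 - ref8 p r k z7 ξ) := by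
  have := hp.L8_pos
  simp only [loopField, Grid.field, u3, Matrix.cons_val]
  field_simp; ring

/-- The deviation of `x₃` in terms of the tracking errors `(e₁, α₁, s₃, α₃)`. -/
noncomputable def currentDeviation (R C K Kb : ℝ) (y : Fin 4 → ℝ) : ℝ :=
  y 2 + (C * K - 1 / R) * y 0 + C * Kb * y 1

/-- The virtual inputs `v₁` and `-v₂` in terms of the tracking errors. -/
noncomputable def virtualInput (R C K Kb Ka K' Kb' : ℝ) (y : Fin 4 → ℝ) : ℝ :=
  K' * y 2 + Kb' * y 3 - C * Kb * Ka * y 0 + (C * K - 1 / R) * (K * y 0 + Kb * y 1)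

/-- The deviation of the power that a converter draws from its source, minus the losses,
in terms of the tracking errors. -/
noncomputable def powerDeviation (R C K Kb Ka K' Kb' L ρ v i : ℝ) (y : Fin 4 → ℝ) : ℝ :=
  i * (y 0 - ρ * currentDeviation R C K Kb y + L * virtualInput R C K Kb Ka K' Kb' y)
    + currentDeviation R C K Kb y * (v - ρ * i + y 0 - ρ * currentDeviation R C K Kb y
      + L * virtualInput R C K Kb Ka K' Kb' y)

/-- The law for `u₁` turns the injected current `(1 - u₁) x₃` into the power `x₃ (x₁ - R₀₂ x₃ + L₃
v₁)` over the denominator of `u₁`, so the node sees a power source. The right-hand side has the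
shape required by `exists_dissipation_of_high_voltage`. -/
theorem loopField_x2 (hp : p.Physical) (h : RegularAt p ξ) {a : ℝ}
    (h2 : 1 / p.R2 * (r.x9 - r.x2) + (1 - a) * (1 / p.R1 * (p.VPV - r.x1)) = 0)
    (h3 : r.x1 - (1 - a) * r.x2
        - (p.R01 * (1 - a) + p.R02 * a) * (1 / p.R1 * (p.VPV - r.x1)) = 0) :
    p.C2 * (loopField p r k w VS ξ).1 1 =
      1 / p.R2 * (ξ.1 8 - r.x9) + (-(1 / p.R2) * (ξ.1 1 - r.x2)
        + ((1 / p.R2 * (r.x2 - r.x9) * (r.x2 + (p.R01 - p.R02) * (1 / p.R1 * (p.VPV - r.x1)))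
          + powerDeviation p.R1 p.C1 k.K1 k.Kb1 k.Ka1 k.K3 k.Kb3 p.L3 p.R02 r.x1
            (1 / p.R1 * (p.VPV - r.x1)) ![ξ.1 0 - r.x1, ξ.2 0, ξ.1 2 - z3 p r k (ξ.1 0) (ξ.2 0), ξ.2 1])
          / (r.x2 + (p.R01 - p.R02) * (1 / p.R1 * (p.VPV - r.x1))
            + (p.R01 - p.R02) * currentDeviation p.R1 p.C1 k.K1 k.Kb1
              ![ξ.1 0 - r.x1, ξ.2 0, ξ.1 2 - z3 p r k (ξ.1 0) (ξ.2 0), ξ.2 1]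
            + (ξ.1 1 - r.x2)) - 1 / p.R2 * (r.x2 - r.x9))) := by
  have := hp.C2_pos
  have := hp.R2_pos
  set i := 1 / p.R1 * (p.VPV - r.x1) with hi
  have hdev : currentDeviation p.R1 p.C1 k.K1 k.Kb1
      ![ξ.1 0 - r.x1, ξ.2 0, ξ.1 2 - z3 p r k (ξ.1 0) (ξ.2 0), ξ.2 1] = ξ.1 2 - i := by
    simp only [currentDeviation, z3, Matrix.cons_val, hi]; ring
  have hv : virtualInput p.R1 p.C1 k.K1 k.Kb1 k.Ka1 k.K3 k.Kb3
      ![ξ.1 0 - r.x1, ξ.2 0, ξ.1 2 - z3 p r k (ξ.1 0) (ξ.2 0), ξ.2 1] =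
        v1 p r k (ξ.1 0) (ξ.1 2) (ξ.2 0) (ξ.2 1) := by
    simp only [virtualInput, v1, Matrix.cons_val]
  have hν : 1 / p.R2 * (r.x2 - r.x9) = (1 - a) * i := by linarith
  -- The steady-state power, written once through the node current and once through the source.
  have hpow : (1 - a) * i * (r.x2 + (p.R01 - p.R02) * i) = i * (r.x1 - p.R02 * i) := by
    linear_combination -i * h3
  have hD : r.x2 + (p.R01 - p.R02) * i + (p.R01 - p.R02) * (ξ.1 2 - i) + (ξ.1 1 - r.x2) =
      ξ.1 1 + (p.R01 - p.R02) * ξ.1 2 := by ring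
  have hD0 := h.1
  rw [powerDeviation, hdev, hv, hD, hν, hpow]
  rw [← sub_eq_zero, ← sub_eq_zero.2 hν.symm]
  simp only [loopField, Grid.field, u1, Matrix.cons_val]
  generalize v1 p r k (ξ.1 0) (ξ.1 2) (ξ.2 0) (ξ.2 1) = v
  obtain ⟨D, hD'⟩ : ∃ D, D = ξ.1 1 + (p.R01 - p.R02) * ξ.1 2 := ⟨_, rfl⟩
  rw [← hD'] at hD0 ⊢
  rw [show ξ.1 1 = D - (p.R01 - p.R02) * ξ.1 2 by rw [hD']; ring]
  field_simp
  ring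

/-- Same mechanism as for `x₂`, but the denominator is `x₅` itself, so its perturbation `δ` is 0. -/
theorem loopField_x5 (hp : p.Physical) (h : RegularAt p ξ) {b : ℝ}
    (h5 : 1 / p.R5 * (r.x9 - r.x5) + (1 - b) * (1 / p.R4 * (p.VB - r.x4)) = 0)
    (h6 : r.x4 - (1 - b) * r.x5 - p.R04 * (1 / p.R4 * (p.VB - r.x4)) = 0) :
    p.C5 * (loopField p r k w VS ξ).1 4 =
      1 / p.R5 * (ξ.1 8 - r.x9) + (-(1 / p.R5) * (ξ.1 4 - r.x5)
        + ((1 / p.R5 * (r.x5 - r.x9) * r.x5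
          + powerDeviation p.R4 p.C4 k.K4 k.Kb4 k.Ka4 k.K6 k.Kb6 p.L6 p.R04 r.x4
            (1 / p.R4 * (p.VB - r.x4)) ![ξ.1 3 - r.x4, ξ.2 2, ξ.1 5 - z6 p r k (ξ.1 3) (ξ.2 2), ξ.2 3])
          / (r.x5 + 0 + (ξ.1 4 - r.x5)) - 1 / p.R5 * (r.x5 - r.x9))) := by
  have := hp.C5_pos
  have := hp.R5_pos
  set i := 1 / p.R4 * (p.VB - r.x4) with hi
  have hdev : currentDeviation p.R4 p.C4 k.K4 k.Kb4
      ![ξ.1 3 - r.x4, ξ.2 2, ξ.1 5 - z6 p r k (ξ.1 3) (ξ.2 2), ξ.2 3] = ξ.1 5 - i := by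
    simp only [currentDeviation, z6, Matrix.cons_val, hi]; ring
  have hv : virtualInput p.R4 p.C4 k.K4 k.Kb4 k.Ka4 k.K6 k.Kb6
      ![ξ.1 3 - r.x4, ξ.2 2, ξ.1 5 - z6 p r k (ξ.1 3) (ξ.2 2), ξ.2 3] =
        -v2 p r k (ξ.1 3) (ξ.1 5) (ξ.2 2) (ξ.2 3) := by
    simp only [virtualInput, v2, Matrix.cons_val]; ring
  have hν : 1 / p.R5 * (r.x5 - r.x9) = (1 - b) * i := by linarith
  have hpow : (1 - b) * i * r.x5 = i * (r.x4 - p.R04 * i) := by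
    linear_combination -i * h6
  have hD : r.x5 + 0 + (ξ.1 4 - r.x5) = ξ.1 4 := by ring
  have hD0 := h.2.1
  rw [powerDeviation, hdev, hv, hD, hν, hpow]
  rw [← sub_eq_zero, ← sub_eq_zero.2 hν.symm]
  simp only [loopField, Grid.field, u2, Matrix.cons_val]
  generalize v2 p r k (ξ.1 3) (ξ.1 5) (ξ.2 2) (ξ.2 3) = v
  field_simp
  ring

theorem loopField_x10 (hp : p.Physical) (hr : p.Feasible r) (h : RegularAt p ξ)
    (h10 : -(3 / 2) * (1 / r.x10) * (p.vld * r.x11 + p.vlq * r.x12)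
        + 1 / p.R10 * (r.x9 - r.x10) = 0) :
    p.C10 * (loopField p r k w VS ξ).1 9 =
      1 / p.R10 * (ξ.1 8 - r.x9) + (-(1 / p.R10) * (ξ.1 9 - r.x10)
        + ((1 / p.R10 * (r.x10 - r.x9) * r.x10
          + -(3 / 2) * (p.vld * (ξ.1 10 - r.x11) + p.vlq * (ξ.1 11 - r.x12)))
          / (r.x10 + 0 + (ξ.1 9 - r.x10)) - 1 / p.R10 * (r.x10 - r.x9))) := by
  have := hp.C10_pos
  have := hp.R10_pos
  have := hr.x10_pos
  have hD0 := h.2.2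
  have hν : 1 / p.R10 * (r.x10 - r.x9) * r.x10 =
      -(3 / 2) * (p.vld * r.x11 + p.vlq * r.x12) := by
    field_simp at h10 ⊢
    linarith
  have hD : r.x10 + 0 + (ξ.1 9 - r.x10) = ξ.1 9 := by ring
  rw [hD, hν]
  simp only [loopField, Grid.field, Matrix.cons_val]
  field_simp
  ring

/-- Replacing `x₇` by `z₇` plus its error reverses the sign of the coupling with `x₂`, `x₅`, `x₁₀`,
making it skew to theirs with `x₉`. -/
theorem loopField_x9 (hp : p.Physical)
    (h9 : 1 / p.R2 * (r.x2 - r.x9) + 1 / p.R5 * (r.x5 - r.x9) + 1 / p.R10 * (r.x10 - r.x9)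
        - 1 / p.RL * r.x9 = 0) :
    p.C9 * (loopField p r k w VS ξ).1 8 =
      -(1 / p.R2 * (ξ.1 1 - r.x2) + 1 / p.R5 * (ξ.1 4 - r.x5) + 1 / p.R10 * (ξ.1 9 - r.x10))
        - (1 / p.R2 + 1 / p.R5 + 1 / p.R7 + 1 / p.R10 + 1 / p.RL) * (ξ.1 8 - r.x9)
        + 1 / p.R7 * (ξ.1 6 - ref7 (busReference p r) ξ) := by
  have := hp.C9_pos
  have := hp.R2_pos
  have := hp.R5_pos
  have := hp.R7_pos
  have := hp.R10_pos
  have := hp.RL_pos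
  rw [← sub_eq_zero, ← sub_eq_zero.2 h9]
  simp only [loopField, Grid.field, Matrix.cons_val, ref7, busReference]
  field_simp
  ring

end ErrorDynamics

/-! ### The composite Lyapunov function and its derivative. -/

section Cascade

variable (p : Grid) (r : Reference)

/-- The tracking error of `x₃`. -/
noncomputable def error3 (ξ : State × Integrators) : ℝ :=
  ξ.1 2 - z3 p r (trackingGains p) (ξ.1 0) (ξ.2 0)

/-- The tracking error of `x₆`. -/
noncomputable def error6 (ξ : State × Integrators) : ℝ :=
  ξ.1 5 - z6 p r (trackingGains p) (ξ.1 3) (ξ.2 2)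

/-- The tracking error of `x₇`. -/
noncomputable def error7 (ξ : State × Integrators) : ℝ :=
  ξ.1 6 - ref7 (busReference p r) ξ

/-- The tracking error of `x₈`. -/
noncomputable def error8 (ξ : State × Integrators) : ℝ :=
  ξ.1 7 - ref8 p r (trackingGains p) (busReference p r) ξ

/-- The errors of the closed loop, as coordinates around the equilibrium. -/
noncomputable def loopErrors (ξ : State × Integrators) : Fin 18 → ℝ :=
  ![ξ.1 1 - r.x2, ξ.1 4 - r.x5, ξ.1 8 - r.x9, ξ.1 9 - r.x10,
    ξ.1 0 - r.x1, ξ.2 0, ξ.1 3 - r.x4, ξ.2 2, error7 p r ξ,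
    error3 p r ξ, ξ.2 1, error6 p r ξ, ξ.2 3, ξ.1 10 - r.x11, ξ.2 4, ξ.1 11 - r.x12, ξ.2 5,
    error8 p r ξ]

/-- The weighted sum of squares of the errors. -/
noncomputable def weightedErrors (c : Fin 18 → ℝ) (ξ : State × Integrators) : ℝ :=
  ∑ i, c i * loopErrors p r ξ i ^ 2

/-- The composite Lyapunov function of the closed loop: the bus voltages are driven by the
source-side errors (weight `M₁`), and these by the current errors (weight `M₀`). -/
noncomputable def cascadeForm (M₁ M₀ : ℝ) (ξ : State × Integrators) : ℝ :=
  p.C2 / 2 * (ξ.1 1 - r.x2) ^ 2 + p.C5 / 2 * (ξ.1 4 - r.x5) ^ 2 + p.C9 / 2 * (ξ.1 8 - r.x9) ^ 2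
    + p.C10 / 2 * (ξ.1 9 - r.x10) ^ 2
    + M₁ * (integralForm (trackingGains p).K1 (ξ.1 0 - r.x1) (ξ.2 0)
      + integralForm (trackingGains p).K4 (ξ.1 3 - r.x4) (ξ.2 2) + error7 p r ξ ^ 2)
    + M₀ * (integralForm 1 (error3 p r ξ) (ξ.2 1) + integralForm 1 (error6 p r ξ) (ξ.2 3)
      + integralForm 1 (ξ.1 10 - r.x11) (ξ.2 4) + integralForm 1 (ξ.1 11 - r.x12) (ξ.2 5)
      + error8 p r ξ ^ 2)

variable {p r}

/-- The derivative of `cascadeForm` along the closed loop. -/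
theorem hasDerivWithinAt_cascadeForm (hp : p.Physical) {M₁ M₀ : ℝ} {ξ : State × Integrators}
    (h : RegularAt p ξ) {γ : ℝ → State × Integrators} {s : Set ℝ} {t : ℝ} (hγt : γ t = ξ)
    {F : State × Integrators}
    (hF : F = loopField p r (trackingGains p) (u3 p r (trackingGains p) (busReference p r)) 1 ξ)
    (hγ : HasDerivWithinAt γ F s t) :
    HasDerivWithinAt (cascadeForm p r M₁ M₀ ∘ γ)
      ((ξ.1 1 - r.x2) * (p.C2 * F.1 1) + (ξ.1 4 - r.x5) * (p.C5 * F.1 4)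
        + (ξ.1 8 - r.x9) * (p.C9 * F.1 8) + (ξ.1 9 - r.x10) * (p.C10 * F.1 9)
        + M₁ * (-(2 * (trackingGains p).K1 - 1) * (ξ.1 0 - r.x1) ^ 2 - ξ.2 0 ^ 2
            + (2 * (ξ.1 0 - r.x1) + ξ.2 0) * -(1 / p.C1 * error3 p r ξ)
          + (-(2 * (trackingGains p).K4 - 1) * (ξ.1 3 - r.x4) ^ 2 - ξ.2 2 ^ 2
            + (2 * (ξ.1 3 - r.x4) + ξ.2 2) * -(1 / p.C4 * error6 p r ξ))
          + 2 * error7 p r ξ * (-error7 p r ξ - 1 / p.C7 * error8 p r ξ))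
        + M₀ * (-(error3 p r ξ ^ 2 + ξ.2 1 ^ 2) - (error6 p r ξ ^ 2 + ξ.2 3 ^ 2)
          - ((ξ.1 10 - r.x11) ^ 2 + ξ.2 4 ^ 2) - ((ξ.1 11 - r.x12) ^ 2 + ξ.2 5 ^ 2)
          - 2 * error8 p r ξ ^ 2)) s t := by
  have := hp.C1_pos
  have := hp.R1_pos
  have := hp.C4_pos
  have := hp.R4_pos
  have := hp.C7_pos
  have := hp.R7_pos
  have hx := hasDerivWithinAt_pi.1 (hasFDerivAt_fst.comp_hasDerivWithinAt t hγ)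
  have hα := hasDerivWithinAt_pi.1 (hasFDerivAt_snd.comp_hasDerivWithinAt t hγ)
  simp only [Function.comp_apply, ContinuousLinearMap.coe_fst', ContinuousLinearMap.coe_snd']
    at hx hα
  have hα0 : HasDerivWithinAt (fun τ => (γ τ).2 0) (ξ.1 0 - r.x1) s t :=
    (hα 0).congr_deriv (by simp [hF, loopField, integratorField, trackingGains])
  have hα1 : HasDerivWithinAt (fun τ => (γ τ).2 1) (error3 p r ξ) s t :=
    (hα 1).congr_deriv (by simp [hF, loopField, integratorField, trackingGains, error3])
  have hα2 : HasDerivWithinAt (fun τ => (γ τ).2 2) (ξ.1 3 - r.x4) s t :=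
    (hα 2).congr_deriv (by simp [hF, loopField, integratorField, trackingGains])
  have hα3 : HasDerivWithinAt (fun τ => (γ τ).2 3) (error6 p r ξ) s t :=
    (hα 3).congr_deriv (by simp [hF, loopField, integratorField, trackingGains, error6])
  have hα4 : HasDerivWithinAt (fun τ => (γ τ).2 4) (ξ.1 10 - r.x11) s t :=
    (hα 4).congr_deriv (by simp [hF, loopField, integratorField, trackingGains])
  have hα5 : HasDerivWithinAt (fun τ => (γ τ).2 5) (ξ.1 11 - r.x12) s t :=
    (hα 5).congr_deriv (by simp [hF, loopField, integratorField, trackingGains])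
  have he1 : HasDerivWithinAt (fun τ => (γ τ).1 0 - r.x1)
      (-(trackingGains p).K1 * (ξ.1 0 - r.x1) - ξ.2 0 + -(1 / p.C1 * error3 p r ξ)) s t :=
    ((hx 0).sub_const r.x1).congr_deriv (by
      rw [hF, loopField_x1 hp, error3]
      simp only [trackingGains]; ring)
  have he4 : HasDerivWithinAt (fun τ => (γ τ).1 3 - r.x4)
      (-(trackingGains p).K4 * (ξ.1 3 - r.x4) - ξ.2 2 + -(1 / p.C4 * error6 p r ξ)) s t :=
    ((hx 3).sub_const r.x4).congr_deriv (by
      rw [hF, loopField_x4 hp, error6]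
      simp only [trackingGains]; ring)
  have he11 : HasDerivWithinAt (fun τ => (γ τ).1 10 - r.x11)
      (-1 * (ξ.1 10 - r.x11) - ξ.2 4 + 0) s t :=
    ((hx 10).sub_const r.x11).congr_deriv (by
      rw [hF, loopField_x11 hp h]
      simp only [trackingGains]; ring)
  have he12 : HasDerivWithinAt (fun τ => (γ τ).1 11 - r.x12)
      (-1 * (ξ.1 11 - r.x12) - ξ.2 5 + 0) s t :=
    ((hx 11).sub_const r.x12).congr_deriv (by
      rw [hF, loopField_x12 hp h]
      simp only [trackingGains]; ring)
  have he3 : HasDerivWithinAt (fun τ => error3 p r (γ τ))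
      (-1 * error3 p r ξ - ξ.2 1 + 0) s t := by
    refine ((hx 2).sub (((((hx 0).const_sub p.VPV).const_mul (1 / p.R1)).add
      (((hx 0).sub_const r.x1).const_mul (p.C1 * (trackingGains p).K1))).add
      (hα0.const_mul (p.C1 * (trackingGains p).Kb1)))).congr_deriv ?_
    rw [hF, loopField_x1 hp, loopField_x3 hp h, error3, v1]
    simp only [trackingGains]
    field_simp
    ring
  have he6 : HasDerivWithinAt (fun τ => error6 p r (γ τ))
      (-1 * error6 p r ξ - ξ.2 3 + 0) s t := by
    refine ((hx 5).sub (((((hx 3).const_sub p.VB).const_mul (1 / p.R4)).add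
      (((hx 3).sub_const r.x4).const_mul (p.C4 * (trackingGains p).K4))).add
      (hα2.const_mul (p.C4 * (trackingGains p).Kb4)))).congr_deriv ?_
    rw [hF, loopField_x4 hp, loopField_x6 hp h, error6, v2]
    simp only [trackingGains]
    field_simp
    ring
  have hr7 : HasDerivWithinAt (fun τ => ref7 (busReference p r) (γ τ))
      (-(2 * p.R7 * (1 / p.R2 * F.1 1 + 1 / p.R5 * F.1 4 + 1 / p.R10 * F.1 9))) s t :=
    ((((((hx 1).sub_const r.x2).const_mul (1 / p.R2)).add
      (((hx 4).sub_const r.x5).const_mul (1 / p.R5))).add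
      (((hx 9).sub_const r.x10).const_mul (1 / p.R10))).const_mul (2 * p.R7)).const_sub r.x9
  -- The reference `z₈` is built from rates computed with `u₃ = 0`; these agree with the true ones
  -- in every component but that of `x₈`.
  have hdrift : ∀ i ≠ 7, (drift p r (trackingGains p) ξ).1 i = F.1 i := by
    intro i hi
    rw [hF, loopField_eq_drift_add]
    simp [hi]
  have he7 : HasDerivWithinAt (fun τ => error7 p r (γ τ))
      (-error7 p r ξ - 1 / p.C7 * error8 p r ξ) s t := by
    refine ((hx 6).sub hr7).congr_deriv ?_
    rw [error8, ref8_busReference, hdrift 1 (by decide), hdrift 4 (by decide),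
      hdrift 9 (by decide), show F.1 6 = _ from hF ▸ loopField_x7 hp, error7]
    simp only [trackingGains]
    field_simp
    ring
  have he8 : HasDerivWithinAt (fun τ => error8 p r (γ τ)) (-error8 p r ξ) s t := by
    have hz : HasFDerivAt (ref8 p r (trackingGains p) (busReference p r)) _ (γ t) :=
      ((contDiffAt_ref8 (trackingGains p) (hγt ▸ h)).differentiableAt (by simp)).hasFDerivAt
    refine ((hx 7).sub (hz.comp_hasDerivWithinAt t hγ)).congr_deriv ?_
    rw [hγt, hF, fderiv_ref8_loopField _ _ _ h, loopField_x8 hp, error8]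
    simp only [trackingGains]
    ring
  subst hγt
  exact ((((((hasDerivWithinAt_half_sq (w := p.C2) (k := r.x2) (hx 1)).add
    (hasDerivWithinAt_half_sq (w := p.C5) (k := r.x5) (hx 4))).add
    (hasDerivWithinAt_half_sq (w := p.C9) (k := r.x9) (hx 8))).add
    (hasDerivWithinAt_half_sq (w := p.C10) (k := r.x10) (hx 9))).add
    (((((hasDerivWithinAt_integralForm he1 hα0).add
      (hasDerivWithinAt_integralForm he4 hα2)).add (he7.pow 2)).const_mul M₁))).add
    ((((((hasDerivWithinAt_integralForm he3 hα1).add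
      (hasDerivWithinAt_integralForm he6 hα3)).add
      (hasDerivWithinAt_integralForm he11 hα4)).add
      (hasDerivWithinAt_integralForm he12 hα5)).add (he8.pow 2)).const_mul M₀)).congr_deriv
    (by push_cast; ring)

end Cascade

/-! ### Definiteness, decay and stability of the cascade. -/

section Cascade

variable {p : Grid} {r : Reference}

theorem regularAt_equilibrium (hr : p.Feasible r) (hh : p.HighVoltage r) :
    RegularAt p (p.equilibrium r, 0) := by
  have := hr.x9_pos
  have := hh.x5_high
  exact ⟨hh.den_pos, by change 0 < r.x5; linarith, hr.x10_pos⟩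

/-- The reference of `x₈` vanishes when all errors but that of `x₈` vanish. -/
theorem ref8_eq_zero (hp : p.Physical) (hr : p.Feasible r) {ξ : State × Integrators}
    (h : RegularAt p ξ) (hξ : ∀ i ≠ 17, loopErrors p r ξ i = 0) :
    ref8 p r (trackingGains p) (busReference p r) ξ = 0 := by
  obtain ⟨a, b, -, h2, h3, h5, h6, -, h10⟩ := hr.exists_duty hp
  have e2 : ξ.1 1 - r.x2 = 0 := hξ 0 (by decide)
  have e5 : ξ.1 4 - r.x5 = 0 := hξ 1 (by decide)
  have e9 : ξ.1 8 - r.x9 = 0 := hξ 2 (by decide)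
  have e10 : ξ.1 9 - r.x10 = 0 := hξ 3 (by decide)
  have e1 : ξ.1 0 - r.x1 = 0 := hξ 4 (by decide)
  have a1 : ξ.2 0 = 0 := hξ 5 (by decide)
  have e4 : ξ.1 3 - r.x4 = 0 := hξ 6 (by decide)
  have a4 : ξ.2 2 = 0 := hξ 7 (by decide)
  have e7 : error7 p r ξ = 0 := hξ 8 (by decide)
  have e3 : error3 p r ξ = 0 := hξ 9 (by decide)
  have a3 : ξ.2 1 = 0 := hξ 10 (by decide)
  have e6 : error6 p r ξ = 0 := hξ 11 (by decide)
  have a6 : ξ.2 3 = 0 := hξ 12 (by decide)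
  have e11 : ξ.1 10 - r.x11 = 0 := hξ 13 (by decide)
  have e12 : ξ.1 11 - r.x12 = 0 := hξ 15 (by decide)
  have hx3 : ξ.1 2 = 1 / p.R1 * (p.VPV - r.x1) := by
    rw [error3, z3, e1, a1, sub_eq_zero.1 e1] at e3
    linarith
  have hz7 : ref7 (busReference p r) ξ = r.x9 := by
    simp [ref7, busReference, e2, e5, e10]
  have hx7 : ξ.1 6 - r.x9 = 0 := by rwa [error7, hz7] at e7
  have d2 : (drift p r (trackingGains p) ξ).1 1 = 0 := by
    have hD : r.x2 + (p.R01 - p.R02) * (1 / p.R1 * (p.VPV - r.x1)) ≠ 0 := by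
      have := h.1.ne'
      rwa [sub_eq_zero.1 e2, hx3] at this
    have := loopField_x2 (k := trackingGains p) (w := fun _ _ => 0) (VS := 0) hp h h2 h3
    rw [← error3, e1, a1, e3, a3, e2, e9] at this
    simpa [powerDeviation, currentDeviation, virtualInput, hD, hp.C2_pos.ne', drift, -one_div]
      using this
  have d5 : (drift p r (trackingGains p) ξ).1 4 = 0 := by
    have hD : r.x5 ≠ 0 := by
      have := h.2.1.ne'
      rwa [sub_eq_zero.1 e5] at this
    have := loopField_x5 (k := trackingGains p) (w := fun _ _ => 0) (VS := 0) hp h h5 h6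
    rw [← error6, e4, a4, e6, a6, e5, e9] at this
    simpa [powerDeviation, currentDeviation, virtualInput, hD, hp.C5_pos.ne', drift, -one_div]
      using this
  have d10 : (drift p r (trackingGains p) ξ).1 9 = 0 := by
    have hD := hr.x10_pos.ne'
    have := loopField_x10 (k := trackingGains p) (w := fun _ _ => 0) (VS := 0) hp hr h h10
    rw [e11, e12, e10, e9] at this
    simpa [hD, hp.C10_pos.ne', drift, -one_div] using this
  rw [ref8_busReference, d2, d5, d10, hz7, hx7, sub_eq_zero.1 e9, sub_eq_zero.1 hx7]
  ring

/-- The errors are triangular in the state: `x₃`, `x₆`, `x₇` are recovered from the other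
coordinates, and `x₈` last, since `z₈` is then 0. -/
theorem eq_equilibrium_of_loopErrors_eq_zero (hp : p.Physical) (hr : p.Feasible r)
    {ξ : State × Integrators} (h : RegularAt p ξ) (hξ : ∀ i, loopErrors p r ξ i = 0) :
    ξ = (p.equilibrium r, 0) := by
  have hz8 := ref8_eq_zero hp hr h fun i _ => hξ i
  simp only [Fin.forall_fin_succ, loopErrors, Matrix.cons_val_zero,
    Matrix.cons_val_succ, IsEmpty.forall_iff] at hξ
  obtain ⟨e2, e5, e9, e10, e1, a1, e4, a4, e7, e3, a3, e6, a6, e11, a11, e12, a12, e8, -⟩ := hξ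
  rw [error3, z3, e1, a1, sub_eq_zero.1 e1] at e3
  rw [error6, z6, e4, a4, sub_eq_zero.1 e4] at e6
  rw [error7, show ref7 (busReference p r) ξ = r.x9 by
    simp [ref7, busReference, e2, e5, e10]] at e7
  rw [error8, hz8, sub_zero] at e8
  refine Prod.ext (eq_equilibrium_of_sub_eq_zero e1 e2 (by linarith) e4 e5 (by linarith) e7 e8 e9
    e10 e11 e12) (funext fun i => ?_)
  fin_cases i <;> assumption

theorem loopErrors_equilibrium (hp : p.Physical) (hr : p.Feasible r) (hh : p.HighVoltage r)
    (i : Fin 18) : loopErrors p r (p.equilibrium r, 0) i = 0 := by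
  have h : ∀ i ≠ 17, loopErrors p r (p.equilibrium r, 0) i = 0 := by
    intro i hi
    fin_cases i <;>
      simp [loopErrors, error3, error6, error7, z3, z6, ref7, busReference, Grid.equilibrium] at hi ⊢
  rcases eq_or_ne i 17 with rfl | hi
  · change 0 - ref8 p r (trackingGains p) (busReference p r) (p.equilibrium r, 0) = 0
    rw [ref8_eq_zero hp hr (regularAt_equilibrium hr hh) h, sub_zero]
  · exact h i hi

theorem weightedErrors_nonneg {c : Fin 18 → ℝ} (hc : ∀ i, 0 < c i) (ξ : State × Integrators) :
    0 ≤ weightedErrors p r c ξ :=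
  Finset.sum_nonneg fun i _ => mul_nonneg (hc i).le (sq_nonneg _)

theorem weightedErrors_pos (hp : p.Physical) (hr : p.Feasible r) {c : Fin 18 → ℝ}
    (hc : ∀ i, 0 < c i) {ξ : State × Integrators} (h : RegularAt p ξ)
    (hξ : ξ ≠ (p.equilibrium r, 0)) : 0 < weightedErrors p r c ξ := by
  by_contra! hle
  exact hξ (eq_equilibrium_of_loopErrors_eq_zero hp hr h fun i =>
    eq_zero_of_weighted_sum_sq_nonpos (fun i _ => hc i) hle i (Finset.mem_univ i))

theorem weightedErrors_eq (c : Fin 18 → ℝ) (ξ : State × Integrators) :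
    weightedErrors p r c ξ = c 0 * (ξ.1 1 - r.x2) ^ 2 + c 1 * (ξ.1 4 - r.x5) ^ 2
      + c 2 * (ξ.1 8 - r.x9) ^ 2 + c 3 * (ξ.1 9 - r.x10) ^ 2 + c 4 * (ξ.1 0 - r.x1) ^ 2
      + c 5 * ξ.2 0 ^ 2 + c 6 * (ξ.1 3 - r.x4) ^ 2 + c 7 * ξ.2 2 ^ 2 + c 8 * error7 p r ξ ^ 2
      + c 9 * error3 p r ξ ^ 2 + c 10 * ξ.2 1 ^ 2 + c 11 * error6 p r ξ ^ 2 + c 12 * ξ.2 3 ^ 2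
      + c 13 * (ξ.1 10 - r.x11) ^ 2 + c 14 * ξ.2 4 ^ 2 + c 15 * (ξ.1 11 - r.x12) ^ 2
      + c 16 * ξ.2 5 ^ 2 + c 17 * error8 p r ξ ^ 2 := by
  simp only [weightedErrors, Fin.sum_univ_succ, Fin.sum_univ_zero, loopErrors,
    Matrix.cons_val_zero, Matrix.cons_val_succ, Fin.succ_zero_eq_one, Fin.succ_one_eq_two]
  simp only [← add_assoc, add_zero]
  rfl

theorem trackingGains_K1_ge (hp : p.Physical) : 1 ≤ (trackingGains p).K1 := by
  have := hp.R1_pos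
  have := hp.C1_pos
  have : 0 < 1 / (p.R1 * p.C1) := by positivity
  simp only [trackingGains]; linarith

theorem trackingGains_K4_ge (hp : p.Physical) : 1 ≤ (trackingGains p).K4 := by
  have := hp.R4_pos
  have := hp.C4_pos
  have : 0 < 1 / (p.R4 * p.C4) := by positivity
  simp only [trackingGains]; linarith

theorem cascadeForm_pos (hp : p.Physical) (hr : p.Feasible r) {M₁ M₀ : ℝ} (hM₁ : 0 < M₁)
    (hM₀ : 0 < M₀) {ξ : State × Integrators} (h : RegularAt p ξ)
    (hξ : ξ ≠ (p.equilibrium r, 0)) : 0 < cascadeForm p r M₁ M₀ ξ := by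
  have := hp.C2_pos
  have := hp.C5_pos
  have := hp.C9_pos
  have := hp.C10_pos
  have hpos := weightedErrors_pos hp hr (c := ![p.C2 / 2, p.C5 / 2, p.C9 / 2, p.C10 / 2,
    M₁ * (1 / 2), M₁ * (1 / 2), M₁ * (1 / 2), M₁ * (1 / 2), M₁,
    M₀ * (1 / 2), M₀ * (1 / 2), M₀ * (1 / 2), M₀ * (1 / 2), M₀ * (1 / 2), M₀ * (1 / 2),
    M₀ * (1 / 2), M₀ * (1 / 2), M₀])
    (fun i => by fin_cases i <;> simp <;> positivity) h hξ
  rw [weightedErrors_eq] at hpos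
  simp only [Matrix.cons_val] at hpos
  have hK1 := trackingGains_K1_ge hp
  have hK4 := trackingGains_K4_ge hp
  have b1 := mul_le_mul_of_nonneg_left (add_le_add
    (le_integralForm (zero_le_one.trans hK1) (ξ.1 0 - r.x1) (ξ.2 0))
    (le_integralForm (zero_le_one.trans hK4) (ξ.1 3 - r.x4) (ξ.2 2))) hM₁.le
  have b0 := mul_le_mul_of_nonneg_left (add_le_add (add_le_add (add_le_add
    (le_integralForm zero_le_one (error3 p r ξ) (ξ.2 1))
    (le_integralForm zero_le_one (error6 p r ξ) (ξ.2 3)))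
    (le_integralForm zero_le_one (ξ.1 10 - r.x11) (ξ.2 4)))
    (le_integralForm zero_le_one (ξ.1 11 - r.x12) (ξ.2 5))) hM₀.le
  rw [cascadeForm]
  linarith

theorem cascadeForm_equilibrium (hp : p.Physical) (hr : p.Feasible r) (hh : p.HighVoltage r)
    {M₁ M₀ : ℝ} : cascadeForm p r M₁ M₀ (p.equilibrium r, 0) = 0 := by
  have h := loopErrors_equilibrium hp hr hh
  simp only [Fin.forall_fin_succ, loopErrors, Matrix.cons_val_zero,
    Matrix.cons_val_succ, IsEmpty.forall_iff] at h
  obtain ⟨e2, e5, e9, e10, e1, a1, e4, a4, e7, e3, a3, e6, a6, e11, a11, e12, a12, e8, -⟩ := h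
  simp [cascadeForm, integralForm, e2, e5, e9, e10, e1, e4, e7, e3, e6, e11, e12, e8]

theorem continuousAt_errors {ξ : State × Integrators} (h : RegularAt p ξ) :
    ContinuousAt (error3 p r) ξ ∧ ContinuousAt (error6 p r) ξ ∧ ContinuousAt (error7 p r) ξ ∧
      ContinuousAt (error8 p r) ξ := by
  refine ⟨?_, ?_, ?_, ?_⟩
  · unfold error3 z3; fun_prop
  · unfold error6 z6; fun_prop
  · unfold error7 ref7 busReference; fun_prop
  · have h1 := (contDiffAt_ref8 (r := r) (trackingGains p) h).continuousAt
    have h2 : Continuous fun ξ : State × Integrators => ξ.1 7 := by fun_prop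
    exact h2.continuousAt.sub h1

theorem continuousAt_cascadeForm (M₁ M₀ : ℝ) {ξ : State × Integrators} (h : RegularAt p ξ) :
    ContinuousAt (cascadeForm p r M₁ M₀) ξ := by
  obtain ⟨h3, h6, h7, h8⟩ := continuousAt_errors (r := r) h
  unfold cascadeForm integralForm
  fun_prop

theorem continuousAt_weightedErrors (c : Fin 18 → ℝ) {ξ : State × Integrators}
    (h : RegularAt p ξ) : ContinuousAt (weightedErrors p r c) ξ := by
  obtain ⟨h3, h6, h7, h8⟩ := continuousAt_errors (r := r) h
  rw [funext (weightedErrors_eq (p := p) (r := r) c)]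
  fun_prop

/-- Weights are chosen from the driven level to the driving one: `2 (A + 1)` leaves `-Y₁` after
paying `A Y₁`, and the last weight leaves `-Y₀` after paying `A Y₀` and `2 (A + 1) C Y₀`. -/
theorem cascade_le {q q₁ q₀ D A C Y₁ Y₀ : ℝ} (hA : 0 ≤ A) (hC : 0 ≤ C)
    (h : q ≤ -D + A * (Y₁ + Y₀)) (h₁ : q₁ ≤ -(1 / 2) * Y₁ + C * Y₀) (h₀ : q₀ ≤ -Y₀) :
    q + 2 * (A + 1) * q₁ + (A + 1 + 2 * (A + 1) * C) * q₀ ≤ -(D + Y₁ + Y₀) := by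
  have e1 := mul_le_mul_of_nonneg_left h₁ (by positivity : 0 ≤ 2 * (A + 1))
  have e0 := mul_le_mul_of_nonneg_left h₀ (by positivity : 0 ≤ A + 1 + 2 * (A + 1) * C)
  linarith

/-- Young's inequality combined with `(2 e + a) ^ 2 ≤ 5 (e ^ 2 + a ^ 2)`, which is the source of the
constant `5 / 2`. -/
theorem integral_error_le {κ c e a s : ℝ} (hκ : 1 ≤ κ) :
    -(2 * κ - 1) * e ^ 2 - a ^ 2 + (2 * e + a) * -(c * s) ≤
      -(1 / 2) * (e ^ 2 + a ^ 2) + 5 / 2 * c ^ 2 * s ^ 2 := by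
  have h1 : 0 ≤ (κ - 1) * e ^ 2 := mul_nonneg (by linarith) (sq_nonneg e)
  nlinarith [sq_nonneg (2 * e + a + 5 * (c * s)), sq_nonneg (e - 2 * a)]

theorem node_le {e X I Z c B n δ Kn Kd S : ℝ} (hB : 0 ≤ B) (hX : X = I + Z)
    (hZ : e * Z ≤ -c * e ^ 2 + B * (n ^ 2 + δ ^ 2)) (hn : n ^ 2 ≤ Kn * S) (hd : δ ^ 2 ≤ Kd * S) :
    e * X ≤ e * I - c * e ^ 2 + B * (Kn + Kd) * S := by
  have := mul_le_mul_of_nonneg_left (add_le_add hn hd) hB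
  rw [hX]
  linarith

/-- The derivative of the composite Lyapunov function, estimated term by term. -/
theorem cascade_derivative_le {e2 e5 e9 e10 e1 a1 e4 a4 s7 s3 a3 s6 a6 e11 a11 e12 a12 s8
    X2 X5 X9 X10 g2 g5 g7 g10 G c2 c5 c10 b2 b5 b10 q1 q4 q7 K1 K4 A C : ℝ}
    (hG : 0 < G) (hb2 : 0 ≤ b2) (hb5 : 0 ≤ b5) (hb10 : 0 ≤ b10) (hK1 : 1 ≤ K1) (hK4 : 1 ≤ K4)
    (n2 : e2 * X2 ≤ e2 * (g2 * e9) - c2 * e2 ^ 2 + b2 * (e1 ^ 2 + a1 ^ 2 + s3 ^ 2 + a3 ^ 2))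
    (n5 : e5 * X5 ≤ e5 * (g5 * e9) - c5 * e5 ^ 2 + b5 * (e4 ^ 2 + a4 ^ 2 + s6 ^ 2 + a6 ^ 2))
    (n10 : e10 * X10 ≤ e10 * (g10 * e9) - c10 * e10 ^ 2 + b10 * (e11 ^ 2 + e12 ^ 2))
    (n9 : X9 = -(g2 * e2 + g5 * e5 + g10 * e10) - G * e9 + g7 * s7)
    (hA : A = b2 + b5 + b10 + g7 ^ 2 / (2 * G))
    (hC : C = 5 / 2 * q1 ^ 2 + 5 / 2 * q4 ^ 2 + q7 ^ 2) :
    e2 * X2 + e5 * X5 + e9 * X9 + e10 * X10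
      + 2 * (A + 1) * (-(2 * K1 - 1) * e1 ^ 2 - a1 ^ 2 + (2 * e1 + a1) * -(q1 * s3)
        + (-(2 * K4 - 1) * e4 ^ 2 - a4 ^ 2 + (2 * e4 + a4) * -(q4 * s6))
        + 2 * s7 * (-s7 - q7 * s8))
      + (A + 1 + 2 * (A + 1) * C) * (-(s3 ^ 2 + a3 ^ 2) - (s6 ^ 2 + a6 ^ 2) - (e11 ^ 2 + a11 ^ 2)
        - (e12 ^ 2 + a12 ^ 2) - 2 * s8 ^ 2) ≤
    -(c2 * e2 ^ 2 + c5 * e5 ^ 2 + G / 2 * e9 ^ 2 + c10 * e10 ^ 2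
      + (e1 ^ 2 + a1 ^ 2 + e4 ^ 2 + a4 ^ 2 + s7 ^ 2)
      + (s3 ^ 2 + a3 ^ 2 + s6 ^ 2 + a6 ^ 2 + e11 ^ 2 + a11 ^ 2 + e12 ^ 2 + a12 ^ 2 + s8 ^ 2)) := by
  -- The effect of the `x₇` error on the bus is absorbed by half of the bus damping `G`.
  have h7 : e9 * (g7 * s7) ≤ G / 2 * e9 ^ 2 + g7 ^ 2 / (2 * G) * s7 ^ 2 := by
    have h1 : 0 ≤ G / 2 * (e9 - g7 * s7 / G) ^ 2 := by positivity
    have h2 : G / 2 * (e9 - g7 * s7 / G) ^ 2 =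
        G / 2 * e9 ^ 2 + g7 ^ 2 / (2 * G) * s7 ^ 2 - e9 * (g7 * s7) := by
      field_simp; ring
    linarith
  have hg : 0 ≤ g7 ^ 2 / (2 * G) := by positivity
  generalize g7 ^ 2 / (2 * G) = g at *
  refine cascade_le (by rw [hA]; positivity) (by rw [hC]; positivity) ?_ ?_ ?_
  · have hsum : b2 * (e1 ^ 2 + a1 ^ 2 + s3 ^ 2 + a3 ^ 2) + b5 * (e4 ^ 2 + a4 ^ 2 + s6 ^ 2 + a6 ^ 2)
        + b10 * (e11 ^ 2 + e12 ^ 2) + g * s7 ^ 2 ≤ A * ((e1 ^ 2 + a1 ^ 2 + e4 ^ 2 + a4 ^ 2 + s7 ^ 2)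
        + (s3 ^ 2 + a3 ^ 2 + s6 ^ 2 + a6 ^ 2 + e11 ^ 2 + a11 ^ 2 + e12 ^ 2 + a12 ^ 2
          + s8 ^ 2)) := by
      rw [hA, add_mul, add_mul, add_mul]
      have := sq_nonneg e1
      have := sq_nonneg a1
      have := sq_nonneg e4
      have := sq_nonneg a4
      have := sq_nonneg s7
      have := sq_nonneg s3
      have := sq_nonneg a3
      have := sq_nonneg s6
      have := sq_nonneg a6
      have := sq_nonneg e11
      have := sq_nonneg a11
      have := sq_nonneg e12
      have := sq_nonneg a12
      have := sq_nonneg s8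
      exact add_le_add (add_le_add (add_le_add (mul_le_mul_of_nonneg_left (by linarith) hb2)
        (mul_le_mul_of_nonneg_left (by linarith) hb5))
        (mul_le_mul_of_nonneg_left (by linarith) hb10))
        (mul_le_mul_of_nonneg_left (by linarith) hg)
    -- The products of `e9` with `e2`, `e5`, `e10` now cancel.
    rw [n9]
    linarith
  · have t1 := integral_error_le (c := q1) (e := e1) (a := a1) (s := s3) hK1
    have t4 := integral_error_le (c := q4) (e := e4) (a := a4) (s := s6) hK4
    have t7 : 2 * s7 * (-s7 - q7 * s8) ≤ -(1 / 2) * s7 ^ 2 + q7 ^ 2 * s8 ^ 2 := by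
      nlinarith only [sq_nonneg (s7 + q7 * s8), sq_nonneg s7]
    have hC1 : q1 ^ 2 * (5 / 2) ≤ C := by rw [hC]; nlinarith only [sq_nonneg q4, sq_nonneg q7]
    have hC4 : q4 ^ 2 * (5 / 2) ≤ C := by rw [hC]; nlinarith only [sq_nonneg q1, sq_nonneg q7]
    have hC7 : q7 ^ 2 ≤ C := by rw [hC]; nlinarith only [sq_nonneg q1, sq_nonneg q4]
    have hC0 : 0 ≤ C := by rw [hC]; positivity
    have m1 := mul_le_mul_of_nonneg_right hC1 (sq_nonneg s3)
    have m4 := mul_le_mul_of_nonneg_right hC4 (sq_nonneg s6)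
    have m7 := mul_le_mul_of_nonneg_right hC7 (sq_nonneg s8)
    have m0 : 0 ≤ C * (a3 ^ 2 + a6 ^ 2 + e11 ^ 2 + a11 ^ 2 + e12 ^ 2 + a12 ^ 2) := by positivity
    linarith
  · linarith [sq_nonneg s8]

set_option maxHeartbeats 1000000 in
/-- The composite Lyapunov function decreases along the closed loop near the equilibrium. -/
theorem exists_cascadeForm_decay (hp : p.Physical) (hr : p.Feasible r) (hh : p.HighVoltage r) :
    ∃ M₁ > 0, ∃ M₀ > 0, ∃ c : Fin 18 → ℝ, (∀ i, 0 < c i) ∧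
      ∀ᶠ ξ in 𝓝 ((p.equilibrium r, 0) : State × Integrators),
        ∀ (γ : ℝ → State × Integrators) (s : Set ℝ) (t : ℝ), γ t = ξ →
          HasDerivWithinAt γ
            (loopField p r (trackingGains p) (u3 p r (trackingGains p) (busReference p r)) 1 ξ) s t →
          ∃ d ≤ -weightedErrors p r c ξ, HasDerivWithinAt (cascadeForm p r M₁ M₀ ∘ γ) d s t := by
  obtain ⟨a, b, -, h2, h3, h5, h6, h9, h10⟩ := hr.exists_duty hp
  set k := trackingGains p with hk
  set i₃ := 1 / p.R1 * (p.VPV - r.x1) with hi₃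
  set i₆ := 1 / p.R4 * (p.VB - r.x4) with hi₆
  have hR2 := hp.R2_pos
  have hR5 := hp.R5_pos
  have hR7 := hp.R7_pos
  have hR10 := hp.R10_pos
  have hRL := hp.RL_pos
  have hx5 : 0 < r.x5 := (regularAt_equilibrium hr hh).2.1
  obtain ⟨c₂, hc₂, B₂, hB₂, ρ₂, hρ₂, est₂⟩ := exists_dissipation_of_high_voltage hR2 hh.den_pos
    (x := r.x2) (v := r.x9) (by have := hh.x2_high; linarith)
  obtain ⟨c₅, hc₅, B₅, hB₅, ρ₅, hρ₅, est₅⟩ := exists_dissipation_of_high_voltage hR5 hx5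
    (x := r.x5) (v := r.x9) (by have := hh.x5_high; linarith)
  obtain ⟨c₁₀, hc₁₀, B₁₀, hB₁₀, ρ₁₀, hρ₁₀, est₁₀⟩ := exists_dissipation_of_high_voltage hR10
    hr.x10_pos (x := r.x10) (v := r.x9) (by have := hh.x10_high; linarith)
  obtain ⟨Kn, hKn, bn⟩ := exists_sq_le_mul_sum_sq (Q := powerDeviation p.R1 p.C1 k.K1 k.Kb1 k.Ka1
    k.K3 k.Kb3 p.L3 p.R02 r.x1 i₃) (by unfold powerDeviation currentDeviation virtualInput; fun_prop)
    (by simp [powerDeviation, currentDeviation, virtualInput])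
  obtain ⟨Kd, hKd, bd⟩ := exists_sq_le_mul_sum_sq
    (Q := fun y => (p.R01 - p.R02) * currentDeviation p.R1 p.C1 k.K1 k.Kb1 y)
    (by unfold currentDeviation; fun_prop) (by simp [currentDeviation])
  obtain ⟨K₅, hK₅, b5⟩ := exists_sq_le_mul_sum_sq (Q := powerDeviation p.R4 p.C4 k.K4 k.Kb4 k.Ka4
    k.K6 k.Kb6 p.L6 p.R04 r.x4 i₆) (by unfold powerDeviation currentDeviation virtualInput; fun_prop)
    (by simp [powerDeviation, currentDeviation, virtualInput])
  obtain ⟨G, hG⟩ : ∃ G, G = 1 / p.R2 + 1 / p.R5 + 1 / p.R7 + 1 / p.R10 + 1 / p.RL := ⟨_, rfl⟩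
  have hG0 : 0 < G := by rw [hG]; positivity
  have hK₁₀ : 0 ≤ 9 / 4 * (p.vld ^ 2 + p.vlq ^ 2) := by positivity
  -- `A` collects the gains from the tracking errors to the bus voltages, and `C` those from the
  -- current errors to the source-side errors.
  obtain ⟨A, hA⟩ : ∃ A, A = B₂ * (Kn + Kd) + B₅ * (K₅ + 0)
    + B₁₀ * (9 / 4 * (p.vld ^ 2 + p.vlq ^ 2) + 0) + (1 / p.R7) ^ 2 / (2 * G) := ⟨_, rfl⟩
  obtain ⟨C, hC⟩ : ∃ C, C = 5 / 2 * (1 / p.C1) ^ 2 + 5 / 2 * (1 / p.C4) ^ 2 + (1 / p.C7) ^ 2 :=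
    ⟨_, rfl⟩
  have hA0 : 0 ≤ A := by rw [hA]; positivity
  have hC0 : 0 ≤ C := by rw [hC]; positivity
  refine ⟨2 * (A + 1), by positivity, A + 1 + 2 * (A + 1) * C, by positivity,
    ![c₂, c₅, G / 2, c₁₀, 1, 1, 1, 1, 1, 1, 1, 1, 1, 1, 1, 1, 1, 1],
    fun i => by fin_cases i <;> simp <;> positivity, ?_⟩
  have h0 := loopErrors_equilibrium hp hr hh
  have hreg := regularAt_equilibrium hr hh
  obtain ⟨ct3, ct6, -, -⟩ := continuousAt_errors (r := r) hreg
  let Y₂ : State × Integrators → Fin 4 → ℝ := fun ξ =>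
    ![ξ.1 0 - r.x1, ξ.2 0, error3 p r ξ, ξ.2 1]
  let Y₅ : State × Integrators → Fin 4 → ℝ := fun ξ =>
    ![ξ.1 3 - r.x4, ξ.2 2, error6 p r ξ, ξ.2 3]
  have hY₂ : Tendsto Y₂ (𝓝 (p.equilibrium r, 0)) (𝓝 0) := by
    have h1 : ContinuousAt Y₂ (p.equilibrium r, 0) := by
      refine continuousAt_pi.2 fun i => ?_
      fin_cases i <;> simp only [Y₂, Fin.zero_eta, Fin.mk_one, Fin.reduceFinMk, Matrix.cons_val] <;>
        fun_prop
    have h2 : Y₂ (p.equilibrium r, 0) = 0 := funext fun i => by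
      fin_cases i
      exacts [h0 4, h0 5, h0 9, h0 10]
    rw [← h2]; exact h1
  have hY₅ : Tendsto Y₅ (𝓝 (p.equilibrium r, 0)) (𝓝 0) := by
    have h1 : ContinuousAt Y₅ (p.equilibrium r, 0) := by
      refine continuousAt_pi.2 fun i => ?_
      fin_cases i <;> simp only [Y₅, Fin.zero_eta, Fin.mk_one, Fin.reduceFinMk, Matrix.cons_val] <;>
        fun_prop
    have h2 : Y₅ (p.equilibrium r, 0) = 0 := funext fun i => by
      fin_cases i
      exacts [h0 6, h0 7, h0 11, h0 12]
    rw [← h2]; exact h1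
  have hsmall : ∀ {φ : State × Integrators → ℝ} {ρ : ℝ}, Continuous φ →
      φ (p.equilibrium r, 0) = 0 → 0 < ρ → ∀ᶠ ξ in 𝓝 (p.equilibrium r, 0), |φ ξ| < ρ :=
    fun hφ h0 hρ => hφ.abs.continuousAt.eventually_lt continuousAt_const (by simpa [h0] using hρ)
  have hdev : ∀ᶠ y : Fin 4 → ℝ in 𝓝 0,
      |(p.R01 - p.R02) * currentDeviation p.R1 p.C1 k.K1 k.Kb1 y| < ρ₂ := by
    have : Continuous fun y => |(p.R01 - p.R02) * currentDeviation p.R1 p.C1 k.K1 k.Kb1 y| := by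
      unfold currentDeviation; fun_prop
    exact this.continuousAt.eventually_lt continuousAt_const (by simpa [currentDeviation] using hρ₂)
  filter_upwards [isOpen_regularAt.mem_nhds hreg, hY₂.eventually bn, hY₂.eventually bd,
    hY₂.eventually hdev, hY₅.eventually b5,
    hsmall (φ := fun ξ => ξ.1 1 - r.x2) (by fun_prop) (h0 0) hρ₂,
    hsmall (φ := fun ξ => ξ.1 4 - r.x5) (by fun_prop) (h0 1) hρ₅,
    hsmall (φ := fun ξ => ξ.1 9 - r.x10) (by fun_prop) (h0 3) hρ₁₀]
    with ξ hξ hn hd hdρ hn5 he2 he5 he10 γ s t hγt hγ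
  refine ⟨_, ?_, hasDerivWithinAt_cascadeForm hp hξ hγt rfl hγ⟩
  have n2 := node_le (e := ξ.1 1 - r.x2) hB₂ (loopField_x2 (k := k)
    (w := u3 p r k (busReference p r)) (VS := 1) hp hξ h2 h3) (est₂ _ _ _ he2 hdρ) hn hd
  have n5 := node_le (e := ξ.1 4 - r.x5) (Kd := 0) hB₅ (loopField_x5 (k := k)
    (w := u3 p r k (busReference p r)) (VS := 1) hp hξ h5 h6)
    (est₅ _ _ 0 he5 (by simpa using hρ₅)) hn5 (by simp)
  have n10 := node_le (e := ξ.1 9 - r.x10) (Kd := 0) (Kn := 9 / 4 * (p.vld ^ 2 + p.vlq ^ 2))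
    (S := (ξ.1 10 - r.x11) ^ 2 + (ξ.1 11 - r.x12) ^ 2) hB₁₀ (loopField_x10 (k := k)
    (w := u3 p r k (busReference p r)) (VS := 1) hp hr hξ h10)
    (est₁₀ _ _ 0 he10 (by simpa using hρ₁₀))
    (by
      -- Cauchy–Schwarz through Lagrange's identity; `9 / 4` is the square of the factor `3 / 2` in
      -- the AC power.
      nlinarith [sq_nonneg (p.vld * (ξ.1 11 - r.x12) - p.vlq * (ξ.1 10 - r.x11))]) (by simp)
  have n9 := loopField_x9 (k := k) (w := u3 p r k (busReference p r)) (VS := 1) (ξ := ξ) hp h9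
  rw [← hG, ← error7] at n9
  have hS₂ : ∑ i, Y₂ ξ i ^ 2 =
      (ξ.1 0 - r.x1) ^ 2 + ξ.2 0 ^ 2 + error3 p r ξ ^ 2 + ξ.2 1 ^ 2 := Fin.sum_univ_four _
  have hS₅ : ∑ i, Y₅ ξ i ^ 2 =
      (ξ.1 3 - r.x4) ^ 2 + ξ.2 2 ^ 2 + error6 p r ξ ^ 2 + ξ.2 3 ^ 2 := Fin.sum_univ_four _
  rw [hS₂] at n2
  rw [hS₅] at n5
  refine (cascade_derivative_le hG0 (by positivity) (by positivity) (by positivity)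
    (trackingGains_K1_ge hp) (trackingGains_K4_ge hp) n2 n5 n10 n9 hA hC).trans (le_of_eq ?_)
  rw [weightedErrors_eq]
  simp only [Matrix.cons_val]
  ring

/-- The explicit laws, with suitable gains, stabilize the equilibrium on the high-voltage
branch. -/
theorem asymptoticallyStable_loopField (hp : p.Physical) (hr : p.Feasible r)
    (hh : p.HighVoltage r) {VS : ℝ → ℝ} (hVS : ∀ t, 0 < VS t) :
    AsymptoticallyStable (fun t ξ => loopField p r (trackingGains p)
      (u3 p r (trackingGains p) (busReference p r)) (VS t) ξ)
      (p.equilibrium r, (0 : Integrators)) := by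
  have hfield : (fun t ξ => loopField p r (trackingGains p)
      (u3 p r (trackingGains p) (busReference p r)) (VS t) ξ) =
      fun _ => loopField p r (trackingGains p)
        (u3 p r (trackingGains p) (busReference p r)) 1 :=
    funext fun t => funext fun ξ => loopField_u3 _ _ (hVS t) ξ
  rw [hfield]
  obtain ⟨M₁, hM₁, M₀, hM₀, c, hc, hdec⟩ := exists_cascadeForm_decay hp hr hh
  have hreg := regularAt_equilibrium hr hh
  have hnear : ∀ᶠ ξ in 𝓝 ((p.equilibrium r, 0) : State × Integrators), RegularAt p ξ :=
    isOpen_regularAt.mem_nhds hreg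
  exact asymptoticallyStable_of_lyapunov (contDiffAt_loopField _ hreg)
    (hnear.mono fun ξ hξ => continuousAt_cascadeForm M₁ M₀ hξ) (cascadeForm_equilibrium hp hr hh)
    (hnear.mono fun ξ hξ => cascadeForm_pos hp hr hM₁ hM₀ hξ)
    (hnear.mono fun ξ hξ => continuousAt_weightedErrors c hξ)
    (.of_forall fun ξ => weightedErrors_nonneg hc ξ)
    (hnear.mono fun ξ hξ => weightedErrors_pos hp hr hc hξ) hdec

end Cascade

end Development

theorem theorem1 (p : Grid) (hp : p.Physical) (r : Reference) (hr : p.Feasible r) :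
    -- a smooth static state feedback (using the value of `V_S`) stabilizes the 12-state model
    (∃ u : ℝ → State → Input,
      (∃ U ∈ 𝓝 (p.equilibrium r),
        ContDiffOn ℝ ∞ (fun q : ℝ × State => u q.1 q.2) (Set.Ioi 0 ×ˢ U)) ∧
      ∀ VS : ℝ → ℝ, (∀ t, 0 < VS t) →
        AsymptoticallyStable (fun t x => p.field (VS t) (u (VS t) x) x) (p.equilibrium r)) ∧
    -- on the high-voltage branch the explicit laws do, for suitable positive gains
    (p.HighVoltage r →
      ∃ k : Gains, k.Positive ∧
      ∃ z7 : ℝ × ℝ × ℝ × ℝ → ℝ,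
        ContDiff ℝ ∞ z7 ∧ z7 (r.x2, r.x5, r.x9, r.x10) = r.x9 ∧
        ∀ VS : ℝ → ℝ, (∀ t, 0 < VS t) →
          AsymptoticallyStable (fun t ξ => loopField p r k (u3 p r k z7) (VS t) ξ)
            (p.equilibrium r, (0 : Integrators))) := by
  refine ⟨exists_smooth_stabilizing_stateFeedback hp hr, fun hh => ⟨trackingGains p,
    trackingGains_positive p hp, busReference p r, contDiff_busReference p r, ?_, fun VS hVS =>
    asymptoticallyStable_loopField hp hr hh hVS⟩⟩
  simp [busReference]
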